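/- Let $\alpha,\varepsilon>0$, $c\in\mathbb{R}$ and $x_\ell<x_r$. For $\Re(s)>0$ let $\lambda_1(s)$ be the unique root with negative real part of $s+c\lambda-\alpha s\lambda^2+\varepsilon\lambda^3=0$, and for $\xi\in\mathbb{R}$ let $\lambda_1(i\xi)=\lim_{\eta\to0^+}\lambda_1(\eta+i\xi)$. Assume that $$\frac c2+\varepsilon\Big(\Re\big(\lambda_1(i\xi)^2\big)-\frac{|\lambda_1(i\xi)|^2}{2}\Big)-\alpha\,\Re\big(i\xi\lambda_1(i\xi)\big)\ge 0\qquad\text{for all }\xi\in\mathbb{R}.$$ Let $u_0:\mathbb{R}\to\mathbb{R}$ be continuous with support contained in $[x_\ell,x_r]$, and let $u:[0,\infty)\times[x_\ell,x_r]\to\mathbb{R}$ be a classical solution of the problem $$\begin{cases} \partial_t(u-\alpha\partial_{xx}u)+c\,\partial_xu+\varepsilon\,\partial_{xxx}u=0, & (t,x)\in(0,\infty)\times(x_\ell,x_r),\\ u(0,x)=u_0(x), & x\in(x_\ell,x_r),\\ \partial_xu(t,x_r)=\mathcal{L}^{-1}(\lambda_1(s))\ast u(t,x_r),\quad \partial_{xx}u(t,x_r)=\mathcal{L}^{-1}(\lambda_1(s)^2)\ast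 u(t,x_r), & t>0,\\ \partial_{xx}u(t,x_\ell)+\mathcal{L}^{-1}\big(\lambda_1(s)-\tfrac{\alpha s}{\varepsilon}\big)\ast\partial_xu(t,x_\ell)+\mathcal{L}^{-1}\big(\lambda_1(s)^2-\tfrac{\alpha s}{\varepsilon}\lambda_1(s)\big)\ast u(t,x_\ell)+\tfrac c\varepsilon u(t,x_\ell)=0, & t>0. \end{cases}$$ Here classical means that $u,\partial_xu$ are continuous on $[0,\infty)\times[x_\ell,x_r]$ and that $\partial_x^ku$ $(k\le3)$ and $\partial_t\partial_x^ku$ $(k\le2)$ exist and are continuous on $(0,\infty)\times[x_\ell,x_r]$; $\mathcal{L}^{-1}$ is the inverse Laplace transform in the sense of distributions (with vertical contours in $\Re(s)>0$), $\ast$ is the causal convolution in $t$ (functions of $t$ being extended by $0$ to $t<0$), and the boundary conditions hold in the sense of distributions on $(0,\infty)$. Then the problem is $H^1$-stable: for every $t>0$, $$\int_{x_\ell}^{x_r}\big(u(t,x)^2+\alpha\,(\partial_xu(t,x))^2\big)\,dx\ \le\ \int_{x_\ell}^{x_r}\big(u_0(x)^2+\alpha\,u_0'(x)^2\big)\,dx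 .$$ -/

import Mathlib

open scoped ContDiff

namespace KdVBBM

/-- The characteristic polynomial `P(s, z) = s + c z - α s z² + ε z³` of the Laplace-transformed
linearized KdV-BBM equation. -/
def charPoly (α c ε : ℝ) (s z : ℂ) : ℂ :=
  s + (c : ℂ) * z - (α : ℂ) * s * z ^ 2 + (ε : ℂ) * z ^ 3

/-- For `Re s > 0`: the root `λ₁(s)` of `P(s, ·)` with negative real part. For `α, ε > 0` and
`Re s > 0` there is exactly one such root. -/
noncomputable def lambda1 (α c ε : ℝ) (s : ℂ) : ℂ :=
  Classical.epsilon fun z : ℂ => charPoly α c ε s z = 0 ∧ z.re < 0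

/-- The boundary value `λ₁(iξ) = lim_{η → 0⁺} λ₁(η + iξ)`. -/
noncomputable def lambda1Bdry (α c ε : ℝ) (ξ : ℝ) : ℂ :=
  Filter.limUnder (nhdsWithin (0 : ℝ) (Set.Ioi 0))
    fun η : ℝ => lambda1 α c ε ((η : ℂ) + (ξ : ℂ) * Complex.I)

/-- The inverse Laplace transform of `F`, as a distribution: the Bromwich integral
`(1 / 2π) ∫ F(σ + iy) e^{(σ + iy) τ} dy` over the line `Re s = σ`, tested against `ψ(τ)`. For `F`
holomorphic of polynomial growth in `Re s > 0` and `ψ` smooth with compact support, the value is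
the same for all `σ > 0`. -/
noncomputable def invLaplace (σ : ℝ) (F : ℂ → ℂ) (ψ : ℝ → ℝ) : ℂ :=
  (1 / (2 * (Real.pi : ℂ))) *
    ∫ y : ℝ, F ((σ : ℂ) + (y : ℂ) * Complex.I) *
      ∫ τ : ℝ, Complex.exp (((σ : ℂ) + (y : ℂ) * Complex.I) * (τ : ℂ)) * (ψ τ : ℂ)

/-- The pairing `⟨𝓛⁻¹(F) ∗ g, φ⟩ = ⟨𝓛⁻¹(F), τ ↦ ∫ g(t) φ(t + τ) dt⟩` of the causal convolution with
a test function `φ` supported in `(0, T)`. Here `g` lives on `[0, ∞)`; as `𝓛⁻¹(F)` is supported in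
`[0, ∞)`, only the values of `g` on `[0, T]` matter, and `g` is cut off at `T`. -/
noncomputable def invLaplaceConv (σ : ℝ) (F : ℂ → ℂ) (T : ℝ) (g φ : ℝ → ℝ) : ℂ :=
  invLaplace σ F fun τ => ∫ t in (0 : ℝ)..T, g t * φ (t + τ)

/-- `φ` is a test function on `(0, T)`. -/
structure IsTest (T : ℝ) (φ : ℝ → ℝ) : Prop where
  smooth : ContDiff ℝ ∞ φ
  compact : HasCompactSupport φ
  supp : tsupport φ ⊆ Set.Ioo 0 T

/-- `∂ₓᵏ u (t, x)` for `x ∈ [xl, xr]` (one-sided at the end points). -/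
noncomputable def dX (xl xr : ℝ) (k : ℕ) (u : ℝ → ℝ → ℝ) (t x : ℝ) : ℝ :=
  iteratedDerivWithin k (u t) (Set.Icc xl xr) x

/-- `∂ₜ ∂ₓᵏ u (t, x)` for `t > 0` and `x ∈ [xl, xr]`. -/
noncomputable def dTdX (xl xr : ℝ) (k : ℕ) (u : ℝ → ℝ → ℝ) (t x : ℝ) : ℝ :=
  deriv (fun τ => dX xl xr k u τ x) t

/-- The regularity of a classical solution: `u, ∂ₓu` are continuous on `[0, ∞) × [xl, xr]`, and
all derivatives that occur in the equation are continuous on `(0, ∞) × [xl, xr]`. -/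
structure IsRegular (xl xr : ℝ) (u : ℝ → ℝ → ℝ) : Prop where
  contDiffOn_zero : ContDiffOn ℝ 1 (u 0) (Set.Icc xl xr)
  contDiffOn_pos : ∀ t : ℝ, 0 < t → ContDiffOn ℝ 3 (u t) (Set.Icc xl xr)
  continuousOn_nonneg : ∀ k : ℕ, k ≤ 1 →
    ContinuousOn (fun p : ℝ × ℝ => dX xl xr k u p.1 p.2) (Set.Ici 0 ×ˢ Set.Icc xl xr)
  continuousOn_pos : ∀ k : ℕ, k ≤ 3 →
    ContinuousOn (fun p : ℝ × ℝ => dX xl xr k u p.1 p.2) (Set.Ioi 0 ×ˢ Set.Icc xl xr)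
  differentiableAt_time : ∀ k : ℕ, k ≤ 2 → ∀ t : ℝ, 0 < t → ∀ x ∈ Set.Icc xl xr,
    DifferentiableAt ℝ (fun τ => dX xl xr k u τ x) t
  continuousOn_time : ∀ k : ℕ, k ≤ 2 →
    ContinuousOn (fun p : ℝ × ℝ => dTdX xl xr k u p.1 p.2) (Set.Ioi 0 ×ˢ Set.Icc xl xr)

/-- `u` solves the linearized KdV-BBM equation on `(0, ∞) × (xl, xr)` with initial datum `u₀` and
the exact transparent boundary conditions, which hold in the sense of distributions on
`(0, ∞)`. -/
structure IsSolution (α c ε xl xr : ℝ) (u₀ : ℝ → ℝ) (u : ℝ → ℝ → ℝ) : Prop where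
  regular : IsRegular xl xr u
  equation : ∀ t : ℝ, 0 < t → ∀ x ∈ Set.Ioo xl xr,
    deriv (fun τ => u τ x - α * dX xl xr 2 u τ x) t
      + c * dX xl xr 1 u t x + ε * dX xl xr 3 u t x = 0
  datum : ∀ x ∈ Set.Ioo xl xr, u 0 x = u₀ x
  /-- `∂ₓu(t, xr) = 𝓛⁻¹(λ₁) ∗ u(·, xr)` -/
  right_first : ∀ (T : ℝ) (φ : ℝ → ℝ), IsTest T φ → ∀ σ : ℝ, 0 < σ →
    ((∫ t in (0 : ℝ)..T, dX xl xr 1 u t xr * φ t : ℝ) : ℂ)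
      = invLaplaceConv σ (fun s => lambda1 α c ε s) T (fun t => u t xr) φ
  /-- `∂ₓₓu(t, xr) = 𝓛⁻¹(λ₁²) ∗ u(·, xr)` -/
  right_second : ∀ (T : ℝ) (φ : ℝ → ℝ), IsTest T φ → ∀ σ : ℝ, 0 < σ →
    ((∫ t in (0 : ℝ)..T, dX xl xr 2 u t xr * φ t : ℝ) : ℂ)
      = invLaplaceConv σ (fun s => lambda1 α c ε s ^ 2) T (fun t => u t xr) φ
  /-- `∂ₓₓu(t, xl) + 𝓛⁻¹(λ₁ - αs/ε) ∗ ∂ₓu(·, xl) + 𝓛⁻¹(λ₁² - (αs/ε) λ₁) ∗ u(·, xl)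
  + (c/ε) u(t, xl) = 0` -/
  left : ∀ (T : ℝ) (φ : ℝ → ℝ), IsTest T φ → ∀ σ : ℝ, 0 < σ →
    ((∫ t in (0 : ℝ)..T, dX xl xr 2 u t xl * φ t : ℝ) : ℂ)
      + invLaplaceConv σ (fun s => lambda1 α c ε s - (α : ℂ) * s / (ε : ℂ)) T
          (fun t => dX xl xr 1 u t xl) φ
      + invLaplaceConv σ
          (fun s => lambda1 α c ε s ^ 2 - (α : ℂ) * s / (ε : ℂ) * lambda1 α c ε s) T
          (fun t => u t xl) φ
      + ((c / ε * ∫ t in (0 : ℝ)..T, u t xl * φ t : ℝ) : ℂ) = 0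

end KdVBBM

/-!
The proof is the energy method. Let `E(t) = ∫ (u² + α (∂ₓu)²) dx`. Testing the equation with `u`
gives `E' = -2 (B(xr) - B(xl))` with the flux `B = c/2 u² + ε (u ∂ₓₓu - (∂ₓu)²/2) - α u ∂ₜ∂ₓu`
(`IsSolution.energy_sub_eq`), so the claim is that the time integral of `B` is nonnegative at
`xr` and nonpositive at `xl`. The boundary conditions turn both integrals into integrals over
the frequency `ξ`, where `s = iξ`, by Parseval's formula.

* At `xr`, `∂ₓu` and `∂ₓₓu` have symbols `λ₁` and `λ₁²`, and the integral of `B` is bounded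
  below by that of `(c/2 + ε (Re λ₁² - |λ₁|²/2) - α Re (iξ λ₁)) |û|²`; cutting `∂ₓu` off at the
  final time only helps, because `-(∂ₓu)²` has the good sign (`exists_tendsto_flux_right`).
* At `xl` there is only one condition, and completing a square gives the integral of `-B`, up
  to an exact derivative, as that of the same expression plus `ε/2 |(∂ₓu)^ + conj λ₁ û|²`
  (`exists_tendsto_flux_left`).

Neither step uses that `𝓛⁻¹(λ₁)` is supported in `[0, ∞)`. Two points need care.

* The boundary conditions are given on the contours `Re s = σ > 0` and tested against smooth
  functions. For a fixed test function the contour is moved to `σ = 0`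
  (`tendsto_invLaplaceConv`), and the resulting identity is extended from test functions to
  `L²(0, T)` (`weak_parseval`). The passage to the limit requires `λ₁` to be bounded, continuous
  on `Re s > 0`, and convergent at every point of the imaginary axis. The root exists by a
  connectedness argument in `s`; it is unique because two roots would give a nonzero solution of
  the resolvent equation on a half line that contradicts its energy balance; and it converges at
  the imaginary axis because its cluster points there lie in the finite set of roots of the
  limiting cubic.
* The symbol `s λ₁` of `∂ₜ∂ₓu` is unbounded, and the solution is differentiable in time for
  `t > 0` only. Since `λ₁ = -1/√α + O(1/s)`, the combination `∂ₜ∂ₓu + ∂ₜu/√α` has a bounded symbol,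
  and the remaining product `u ∂ₜu` is an exact derivative, whose contribution has the good sign
  because `u = 0` at both end points at `t = 0`.
-/

open scoped ContDiff

namespace KdVBBM

open Filter Topology Set MeasureTheory
open scoped ComplexConjugate FourierTransform

/-! ### The root of the characteristic polynomial in the left half plane -/

section Roots

variable {α c ε : ℝ}

lemma continuous_charPoly (α c ε : ℝ) :
    Continuous fun p : ℂ × ℂ => charPoly α c ε p.1 p.2 := by
  unfold charPoly; fun_prop

/-- For `Re s > 0` the characteristic polynomial has no root on the imaginary axis. -/
lemma re_ne_zero_of_charPoly_eq_zero (hα : 0 < α) {s z : ℂ} (hs : 0 < s.re)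
    (h : charPoly α c ε s z = 0) : z.re ≠ 0 := by
  intro hz
  have h1 := congrArg Complex.re h
  simp [charPoly, pow_succ, hz] at h1
  nlinarith [mul_nonneg hs.le (mul_nonneg hα.le (sq_nonneg z.im))]

/-- The mixed energy identity for two roots `p`, `q`: on the half line `x > 0`, it is the equation
tested with the mode `e^{qx}` and integrated by parts. -/
lemma charPoly_cross_identity {s p q : ℂ} (hp : charPoly α c ε s p = 0)
    (hq : charPoly α c ε s q = 0) :
    2 * (s.re : ℂ) * (1 + α * (p * conj q)) =
      (p + conj q) * (α * (s * p + conj s * conj q) - c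
        - ε * (p ^ 2 - p * conj q + conj q ^ 2)) := by
  have hq' := congrArg conj hq
  simp only [charPoly, map_add, map_sub, map_mul, map_pow, Complex.conj_ofReal, map_zero] at hq'
  unfold charPoly at hp
  have hs : 2 * (s.re : ℂ) = s + conj s := by rw [Complex.add_conj]; push_cast; ring
  rw [hs]
  linear_combination hp + hq'

/-- Two distinct roots in the left half plane would give a decaying solution `e^{px} - e^{qx}` of
the resolvent equation on the half line `x > 0` that vanishes at `x = 0`; its energy balance is
contradictory. -/
lemma charPoly_root_unique (hα : 0 < α) (hε : 0 < ε) {s p q : ℂ} (hs : 0 < s.re)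
    (hp : charPoly α c ε s p = 0) (hp0 : p.re < 0)
    (hq : charPoly α c ε s q = 0) (hq0 : q.re < 0) : p = q := by
  by_contra hne
  have hpp := charPoly_cross_identity hp hp
  have hqq := charPoly_cross_identity hq hq
  have hpq := charPoly_cross_identity hp hq
  set X : ℂ → ℂ → ℂ := fun p q => α * (s * p + conj s * conj q) - c
        - ε * (p ^ 2 - p * conj q + conj q ^ 2) with hX
  change _ = _ * X p p at hpp
  change _ = _ * X q q at hqq
  change _ = _ * X p q at hpq
  have hsum : (X p p).re + (X q q).re - 2 * (X p q).re = ε * Complex.normSq (p - q) := by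
    simp [hX, pow_two, Complex.normSq_apply]
    ring
  have hpos : 0 < ε * Complex.normSq (p - q) :=
    mul_pos hε (Complex.normSq_pos.2 (sub_ne_zero.2 hne))
  set a := -p.re
  set b := -q.re
  have ha : 0 < a := by simp [a, hp0]
  have hb : 0 < b := by simp [b, hq0]
  have key : ∀ p : ℂ, p.re < 0 →
      2 * (s.re : ℂ) * (1 + α * (p * conj p)) = (p + conj p) * X p p →
      (X p p).re = - (s.re * ((1 + α * ‖p‖ ^ 2) / (-p.re))) := by
    intro p hp0 h
    have h1 := congrArg Complex.re h
    rw [Complex.mul_conj, Complex.add_conj, Complex.normSq_eq_norm_sq] at h1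
    have h2 : 2 * (s.re : ℂ) * (1 + α * ((‖p‖ ^ 2 : ℝ) : ℂ))
        = ((2 * s.re * (1 + α * ‖p‖ ^ 2) : ℝ) : ℂ) := by push_cast; ring
    rw [h2, Complex.ofReal_re, Complex.re_ofReal_mul] at h1
    have : p.re ≠ 0 := hp0.ne
    field_simp
    linarith
  have hX1 := key p hp0 hpp
  have hX2 := key q hq0 hqq
  have hX3 : -(X p q).re ≤ 2 * s.re * ((1 + α * (‖p‖ * ‖q‖)) / (a + b)) := by
    have h1 : ‖p + conj q‖ * ‖X p q‖ ≤ 2 * s.re * (1 + α * (‖p‖ * ‖q‖)) := by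
      rw [← norm_mul, ← hpq, norm_mul]
      have e1 : ‖(2 * (s.re : ℂ))‖ = 2 * s.re := by
        rw [norm_mul, Complex.norm_real, Real.norm_of_nonneg hs.le]; simp
      rw [e1]
      gcongr
      refine (norm_add_le _ _).trans ?_
      simp [abs_of_pos hα]
    have h2 : a + b ≤ ‖p + conj q‖ := by
      refine le_trans ?_ (Complex.abs_re_le_norm _)
      refine le_trans ?_ (neg_le_abs _)
      simp [a, b]
    have h3 : -(X p q).re ≤ ‖X p q‖ := (neg_le_abs _).trans (Complex.abs_re_le_norm _)
    rw [← mul_div_assoc, le_div_iff₀ (by positivity)]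
    nlinarith [norm_nonneg (X p q), mul_le_mul_of_nonneg_right h2 (norm_nonneg (X p q))]
  -- the energy of `e^{px} - e^{qx}` is nonnegative
  have t1 : 4 * ((1 + α * (‖p‖ * ‖q‖)) / (a + b))
      ≤ (1 + α * ‖p‖ ^ 2) / a + (1 + α * ‖q‖ ^ 2) / b := by
    rw [div_add_div _ _ ha.ne' hb.ne', ← mul_div_assoc, div_le_div_iff₀ (by positivity)
      (by positivity)]
    have e : ((1 + α * ‖p‖ ^ 2) * b + a * (1 + α * ‖q‖ ^ 2)) * (a + b)
        - 4 * (1 + α * (‖p‖ * ‖q‖)) * (a * b)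
        = (a - b) ^ 2 + α * ((‖p‖ * b - ‖q‖ * a) ^ 2 + a * b * (‖p‖ - ‖q‖) ^ 2) := by ring
    have : 0 ≤ (a - b) ^ 2 + α * ((‖p‖ * b - ‖q‖ * a) ^ 2 + a * b * (‖p‖ - ‖q‖) ^ 2) := by
      positivity
    linarith
  have t2 := mul_le_mul_of_nonneg_left t1 hs.le
  change (X p p).re = - (s.re * (_ / a)) at hX1
  change (X q q).re = - (s.re * (_ / b)) at hX2
  nlinarith

/-- A root in the left half plane is bounded independently of `s`: it satisfies
`Re s |α z² - 1|² ≤ (α |z|² - 1) (ε |z|² + c) Re z`, where the right-hand side is negative for large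
`|z|`. -/
lemma normSq_le_of_charPoly_eq_zero (hα : 0 < α) (hε : 0 < ε) {s z : ℂ} (hs : 0 < s.re)
    (h : charPoly α c ε s z = 0) (hz : z.re < 0) : ‖z‖ ^ 2 ≤ max (1 / α) (|c| / ε) := by
  by_contra! hlt
  obtain ⟨h1, h2⟩ := max_lt_iff.1 hlt
  rw [div_lt_iff₀ hα] at h1
  rw [div_lt_iff₀ hε] at h2
  have e : s * (α * z ^ 2 - 1) = z * (c + ε * z ^ 2) := by
    unfold charPoly at h; linear_combination -h
  have e2 : s * ((Complex.normSq (α * z ^ 2 - 1) : ℝ) : ℂ)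
      = z * (c + ε * z ^ 2) * conj (α * z ^ 2 - 1) := by
    rw [← e, mul_assoc, Complex.mul_conj]
  have e3 := congrArg Complex.re e2
  rw [Complex.re_mul_ofReal] at e3
  rw [← Complex.normSq_eq_norm_sq] at h1 h2
  rw [Complex.normSq_apply z] at h1 h2
  have e4 : (z * (c + ε * z ^ 2) * conj (α * z ^ 2 - 1)).re
      = z.re * ((α * (z.re * z.re + z.im * z.im) - 1) * (ε * (z.re * z.re + z.im * z.im) + c)
        + 4 * ε * z.im ^ 2) := by
    simp [pow_two]
    ring
  have h3 : 0 < ε * (z.re * z.re + z.im * z.im) + c := by linarith [neg_abs_le c]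
  have h4 : 0 < α * (z.re * z.re + z.im * z.im) - 1 := by linarith
  have h5 : 0 ≤ s.re * Complex.normSq (α * z ^ 2 - 1) :=
    mul_nonneg hs.le (Complex.normSq_nonneg _)
  rw [e3, e4] at h5
  have h6 : 0 < (α * (z.re * z.re + z.im * z.im) - 1) * (ε * (z.re * z.re + z.im * z.im) + c)
        + 4 * ε * z.im ^ 2 := by positivity
  nlinarith

/-- The characteristic polynomial, as an element of `ℂ[X]`. -/
noncomputable def charCubic (α c ε : ℝ) (s : ℂ) : Cubic ℂ := ⟨ε, -(α * s), c, s⟩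

lemma eval_charCubic (s z : ℂ) : (charCubic α c ε s).toPoly.eval z = charPoly α c ε s z := by
  simp [charCubic, Cubic.toPoly, charPoly]
  ring

lemma exists_charPoly_eq_prod (hε : 0 < ε) (s : ℂ) : ∃ x y w : ℂ, ∀ z,
    charPoly α c ε s z = ε * ((z - x) * (z - y) * (z - w)) := by
  have ha : (charCubic α c ε s).a ≠ 0 := by
    simpa [charCubic] using hε.ne'
  obtain ⟨x, y, w, h⟩ := (Cubic.splits_iff_roots_eq_three (φ := RingHom.id ℂ) ha).1
    (IsAlgClosed.splits _)
  refine ⟨x, y, w, fun z => ?_⟩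
  have h2 := Cubic.eq_prod_three_roots ha h
  have h3 := congrArg (Polynomial.eval z) h2
  rw [Cubic.map] at h3
  simp only [RingHom.id_apply] at h3
  rw [← eval_charCubic]
  rw [show (charCubic α c ε s).toPoly.eval z = _ from h3]
  simp [charCubic, mul_assoc]

lemma finite_setOf_charPoly_eq_zero (hε : 0 < ε) (s : ℂ) :
    {z : ℂ | charPoly α c ε s z = 0}.Finite := by
  obtain ⟨x, y, w, h⟩ := exists_charPoly_eq_prod (α := α) (c := c) hε s
  refine Set.Finite.subset (s := {x, y, w}) (by simp) fun z hz => ?_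
  have hz' : charPoly α c ε s z = 0 := hz
  rw [h] at hz'
  simpa [hε.ne', sub_eq_zero, or_assoc] using hz'

lemma isOpen_setOf_exists_root (hε : 0 < ε) :
    IsOpen {s : ℂ | ∃ z, charPoly α c ε s z = 0 ∧ z.re < 0} := by
  rw [isOpen_iff_mem_nhds]
  rintro s ⟨z, hz, hz0⟩
  have hc : Continuous fun s' => ‖charPoly α c ε s' z‖ :=
    ((continuous_charPoly α c ε).comp (by fun_prop : Continuous fun s' : ℂ => (s', z))).norm
  have hlt : ‖charPoly α c ε s z‖ < ε * (-z.re) ^ 3 := by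
    rw [hz, norm_zero]
    have : 0 < -z.re := by linarith
    positivity
  filter_upwards [hc.continuousAt.eventually_lt continuousAt_const hlt] with s' hs'
  obtain ⟨x, y, w, h⟩ := exists_charPoly_eq_prod (α := α) (c := c) hε s'
  -- `|P(s', z)| = ε |z - x| |z - y| |z - w|` is small, so one of the roots is close to `z`
  have hroot : ∀ r, charPoly α c ε s' r = 0 → r.re < 0 ∨ -z.re ≤ ‖z - r‖ := by
    intro r _
    by_contra! hcon
    have := (neg_le_abs _).trans (Complex.abs_re_le_norm (z - r))
    simp at this
    linarith [hcon.1, hcon.2]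
  by_contra hno
  replace hno : ∀ r, charPoly α c ε s' r = 0 → ¬ r.re < 0 := fun r h1 h2 => hno ⟨r, h1, h2⟩
  have hx := (hroot x (by rw [h]; simp)).resolve_left (hno x (by rw [h]; simp))
  have hy := (hroot y (by rw [h]; simp)).resolve_left (hno y (by rw [h]; simp))
  have hw := (hroot w (by rw [h]; simp)).resolve_left (hno w (by rw [h]; simp))
  rw [h, norm_mul, norm_mul, norm_mul, Complex.norm_real, Real.norm_of_nonneg hε.le] at hs'
  have : (-z.re) ^ 3 ≤ ‖z - x‖ * ‖z - y‖ * ‖z - w‖ := by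
    have h0 : 0 ≤ -z.re := by linarith
    calc (-z.re) ^ 3 = (-z.re) * (-z.re) * (-z.re) := by ring
      _ ≤ _ := by gcongr
  nlinarith

/-- Limits of roots in the left half plane are such roots, as long as `Re s > 0`. -/
lemma re_neg_of_mapClusterPt (hα : 0 < α) {ι : Type*} {l : Filter ι} {S Z : ι → ℂ}
    {s z : ℂ} (hs : 0 < s.re) (hS : Tendsto S l (𝓝 s)) (hz : MapClusterPt z l Z)
    (hZ : ∀ᶠ i in l, charPoly α c ε (S i) (Z i) = 0 ∧ (Z i).re < 0) :
    charPoly α c ε s z = 0 ∧ z.re < 0 := by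
  obtain ⟨U, hU, hUz⟩ := mapClusterPt_iff_ultrafilter.1 hz
  have h0 : charPoly α c ε s z = 0 := by
    have : Tendsto (fun i => charPoly α c ε (S i) (Z i)) U (𝓝 (charPoly α c ε s z)) :=
      ((continuous_charPoly α c ε).tendsto (s, z)).comp ((hS.mono_left hU).prodMk_nhds hUz)
    refine tendsto_nhds_unique this (tendsto_const_nhds.congr' ?_)
    filter_upwards [hU hZ] with i hi using hi.1.symm
  have h1 : z.re ≤ 0 := by
    refine le_of_tendsto ((Complex.continuous_re.tendsto z).comp hUz) ?_
    filter_upwards [hU hZ] with i hi using hi.2.le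
  exact ⟨h0, lt_of_le_of_ne h1 (re_ne_zero_of_charPoly_eq_zero hα hs h0)⟩

lemma norm_le_of_root (hα : 0 < α) (hε : 0 < ε) {s z : ℂ} (hs : 0 < s.re)
    (h : charPoly α c ε s z = 0 ∧ z.re < 0) : ‖z‖ ≤ √(max (1 / α) (|c| / ε)) :=
  Real.le_sqrt_of_sq_le (normSq_le_of_charPoly_eq_zero hα hε hs h.1 h.2)

/-- Existence holds for real `s` by the intermediate value theorem, and propagates to the whole half
plane because the set of `s` where it holds is open and relatively closed. -/
lemma exists_root (hα : 0 < α) (hε : 0 < ε) {s : ℂ} (hs : 0 < s.re) :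
    ∃ z, charPoly α c ε s z = 0 ∧ z.re < 0 := by
  set A : Set ℂ := {s : ℂ | 0 < s.re} with hA
  have hAc : IsPreconnected A := (convex_halfSpace_re_gt 0).isPreconnected
  set V : Set ℂ := {s : ℂ | ∃ z, charPoly α c ε s z = 0 ∧ z.re < 0} with hV
  have hne : (A ∩ V).Nonempty := by
    refine ⟨1, by simp [hA], ?_⟩
    -- the cubic `1 + c x - α x² + ε x³` is `1` at `0` and negative at `-N` for `N` large
    set f : ℝ → ℝ := fun x => 1 + c * x - α * x ^ 2 + ε * x ^ 3 with hf
    have hfc : ContinuousOn f (Icc (-(1 + (1 + |c|) / α)) 0) := by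
      apply Continuous.continuousOn; fun_prop
    set N := 1 + (1 + |c|) / α with hN
    have hN1 : 1 ≤ N := by
      have : 0 ≤ (1 + |c|) / α := by positivity
      linarith
    have hNα : α * N = α + 1 + |c| := by rw [hN]; field_simp; ring
    have hneg : f (-N) ≤ 0 := by
      have e : f (-N) = 1 - c * N - (α * N) * N - ε * N ^ 3 := by simp only [hf]; ring
      rw [e, hNα]
      have h3 : 0 ≤ ε * N ^ 3 := by positivity
      have h4 := mul_le_mul_of_nonneg_right (neg_abs_le c) (by linarith : 0 ≤ N)
      nlinarith
    have := intermediate_value_Icc (by linarith : -N ≤ 0) hfc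
    obtain ⟨x, hx, hx0⟩ := this ⟨hneg, by simp [hf]⟩
    refine ⟨x, ?_, ?_⟩
    · have := congrArg (fun r : ℝ => (r : ℂ)) hx0
      simp only [hf] at this
      push_cast at this
      unfold charPoly
      linear_combination this
    · rw [Complex.ofReal_re]
      refine lt_of_le_of_ne hx.2 fun h => ?_
      subst h
      simp [hf] at hx0
  have hsub : closure V ∩ A ⊆ V := by
    rintro s ⟨hs, hsA⟩
    obtain ⟨S, hSV, hSs⟩ := mem_closure_iff_seq_limit.1 hs
    choose Z hZ using hSV
    have hev : ∀ᶠ n in atTop, 0 < (S n).re :=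
      ((Complex.continuous_re.tendsto s).comp hSs).eventually (lt_mem_nhds hsA)
    obtain ⟨z, -, hz⟩ := (isCompact_closedBall (0 : ℂ)
      (√(max (1 / α) (|c| / ε)))).exists_mapClusterPt (f := atTop) (u := Z) (by
        rw [le_principal_iff, mem_map]
        filter_upwards [hev] with n hn
        simpa using norm_le_of_root hα hε hn (hZ n))
    exact ⟨z, re_neg_of_mapClusterPt hα hsA hSs hz (Eventually.of_forall hZ)⟩
  exact hAc.subset_of_closure_inter_subset (isOpen_setOf_exists_root hε) hne hsub hs

lemma lambda1_spec (hα : 0 < α) (hε : 0 < ε) {s : ℂ} (hs : 0 < s.re) :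
    charPoly α c ε s (lambda1 α c ε s) = 0 ∧ (lambda1 α c ε s).re < 0 :=
  Classical.epsilon_spec (exists_root hα hε hs)

lemma norm_lambda1_le (hα : 0 < α) (hε : 0 < ε) {s : ℂ} (hs : 0 < s.re) :
    ‖lambda1 α c ε s‖ ≤ √(max (1 / α) (|c| / ε)) :=
  norm_le_of_root hα hε hs (lambda1_spec hα hε hs)

lemma continuousAt_lambda1 (hα : 0 < α) (hε : 0 < ε) {s : ℂ} (hs : 0 < s.re) :
    ContinuousAt (lambda1 α c ε) s := by
  have hev : ∀ᶠ s' in 𝓝 s, 0 < s'.re :=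
    (Complex.continuous_re.tendsto s).eventually (lt_mem_nhds hs)
  refine (isCompact_closedBall (0 : ℂ)
    (√(max (1 / α) (|c| / ε)))).tendsto_nhds_of_unique_mapClusterPt ?_ ?_
  · filter_upwards [hev] with s' hs'
    simpa using norm_lambda1_le hα hε hs'
  · intro z _ hz
    have := re_neg_of_mapClusterPt (S := id) hα hs tendsto_id hz (by
      filter_upwards [hev] with s' hs' using lambda1_spec hα hε hs')
    exact charPoly_root_unique hα hε hs this.1 this.2 (lambda1_spec hα hε hs).1
      (lambda1_spec hα hε hs).2

/-- A bounded continuous function on `(0, ∞)` with finitely many cluster points at `0` has a limit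
there: otherwise the distance to one of them takes, by the intermediate value theorem, every small
value arbitrarily close to `0`. -/
lemma exists_tendsto_of_finite_mapClusterPt {f : ℝ → ℂ} (hf : ContinuousOn f (Ioi 0)) {C : ℝ}
    (hC : ∀ x, 0 < x → ‖f x‖ ≤ C) {S : Set ℂ} (hS : S.Finite)
    (hcl : ∀ z, MapClusterPt z (𝓝[>] (0 : ℝ)) f → z ∈ S) :
    ∃ z, Tendsto f (𝓝[>] (0 : ℝ)) (𝓝 z) := by
  have hmem : ∀ᶠ x in 𝓝[>] (0 : ℝ), f x ∈ Metric.closedBall (0 : ℂ) C := by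
    filter_upwards [self_mem_nhdsWithin] with x hx
    simpa using hC x hx
  obtain ⟨z, -, hz⟩ := (isCompact_closedBall (0 : ℂ) C).exists_mapClusterPt
    (f := 𝓝[>] (0 : ℝ)) (u := f) (le_principal_iff.2 hmem)
  refine ⟨z, ?_⟩
  by_contra hnot
  rw [Metric.tendsto_nhds] at hnot
  push Not at hnot
  obtain ⟨e, he, hfar⟩ := hnot
  obtain ⟨δ, hδ, hδS⟩ : ∃ δ ∈ Ioo 0 e, δ ∉ (fun w => dist w z) '' S :=
    ((Ioo_infinite he).sdiff (hS.image _)).nonempty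
  have hfreq : ∃ᶠ x in 𝓝[>] (0 : ℝ), f x ∈ Metric.closedBall 0 C ∩ Metric.sphere z δ := by
    refine (Frequently.and_eventually ?_ hmem).mono fun x hx => ⟨hx.2, hx.1⟩
    rw [(nhdsGT_basis (0 : ℝ)).frequently_iff]
    intro η hη
    have hIoo : Ioo (0 : ℝ) η ∈ 𝓝[>] (0 : ℝ) := Ioo_mem_nhdsGT hη
    obtain ⟨x₁, hx₁, hx₁'⟩ := (hfar.and_eventually hIoo).exists
    obtain ⟨x₂, hx₂, hx₂'⟩ := ((hz.frequently (Metric.ball_mem_nhds z hδ.1)).and_eventually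
      hIoo).exists
    have hcont : ContinuousOn (fun x => dist (f x) z) (Ioo 0 η) :=
      (continuous_id.dist continuous_const).comp_continuousOn (hf.mono Ioo_subset_Ioi_self)
    obtain ⟨x, hx, hx'⟩ := isPreconnected_Ioo.intermediate_value hx₂' hx₁' hcont
      ⟨(Metric.mem_ball.1 hx₂).le, hδ.2.le.trans hx₁⟩
    exact ⟨x, hx, hx'⟩
  obtain ⟨w, hw, hwc⟩ := ((isCompact_closedBall (0 : ℂ) C).inter_right
    (Metric.isClosed_sphere (x := z) (ε := δ))).exists_mapClusterPt_of_frequently hfreq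
  exact hδS ⟨w, hcl w hwc, hw.2⟩

lemma tendsto_line (y : ℝ) :
    Tendsto (fun σ : ℝ => (σ : ℂ) + (y : ℂ) * Complex.I) (𝓝[>] (0 : ℝ)) (𝓝 (y * Complex.I)) := by
  have hline : Continuous fun η : ℝ => (η : ℂ) + (y : ℂ) * Complex.I := by fun_prop
  have := (hline.tendsto 0).mono_left (nhdsWithin_le_nhds (s := Ioi 0))
  simpa using this

lemma tendsto_lambda1Bdry (hα : 0 < α) (hε : 0 < ε) (ξ : ℝ) :
    Tendsto (fun η : ℝ => lambda1 α c ε ((η : ℂ) + (ξ : ℂ) * Complex.I)) (𝓝[>] (0 : ℝ))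
      (𝓝 (lambda1Bdry α c ε ξ)) := by
  have hline : Continuous fun η : ℝ => (η : ℂ) + (ξ : ℂ) * Complex.I := by fun_prop
  have hre : ∀ η : ℝ, ((η : ℂ) + (ξ : ℂ) * Complex.I).re = η := by simp
  refine tendsto_nhds_limUnder ?_
  refine exists_tendsto_of_finite_mapClusterPt (C := √(max (1 / α) (|c| / ε))) ?_ ?_
    (finite_setOf_charPoly_eq_zero (α := α) (c := c) hε (ξ * Complex.I)) ?_
  · intro η hη
    have := continuousAt_lambda1 (c := c) hα hε (s := (η : ℂ) + (ξ : ℂ) * Complex.I)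
      (by rw [hre]; exact hη)
    exact (ContinuousAt.comp (f := fun η : ℝ => (η : ℂ) + (ξ : ℂ) * Complex.I) this
      hline.continuousAt).continuousWithinAt
  · intro η hη
    exact norm_lambda1_le hα hε (by rw [hre]; exact hη)
  · intro z hz
    obtain ⟨U, hU, hUz⟩ := mapClusterPt_iff_ultrafilter.1 hz
    have := ((continuous_charPoly α c ε).tendsto (ξ * Complex.I, z)).comp
      (((tendsto_line ξ).mono_left hU).prodMk_nhds hUz)
    refine tendsto_nhds_unique this (tendsto_const_nhds.congr' ?_)
    filter_upwards [hU self_mem_nhdsWithin] with η hη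
    exact (lambda1_spec hα hε (by rw [hre]; exact hη)).1.symm

lemma measurable_lambda1_line (hα : 0 < α) (hε : 0 < ε) {σ : ℝ} (hσ : 0 < σ) :
    Measurable fun y : ℝ => lambda1 α c ε ((σ : ℂ) + (y : ℂ) * Complex.I) := by
  refine Continuous.measurable ?_
  rw [continuous_iff_continuousAt]
  intro y
  exact ContinuousAt.comp (f := fun y : ℝ => (σ : ℂ) + (y : ℂ) * Complex.I)
    (continuousAt_lambda1 hα hε (by simpa using hσ))
    (Continuous.continuousAt (by fun_prop))

lemma measurable_lambda1Bdry (hα : 0 < α) (hε : 0 < ε) : Measurable (lambda1Bdry α c ε) := by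
  obtain ⟨v, -, hv0, hv⟩ := exists_seq_strictAnti_tendsto (0 : ℝ)
  have hv' : Tendsto v atTop (𝓝[>] (0 : ℝ)) :=
    tendsto_nhdsWithin_iff.2 ⟨hv, Eventually.of_forall hv0⟩
  refine measurable_of_tendsto_metrizable (f := fun n (y : ℝ) =>
    lambda1 α c ε ((v n : ℂ) + (y : ℂ) * Complex.I))
    (fun n => measurable_lambda1_line hα hε (hv0 n)) ?_
  rw [tendsto_pi_nhds]
  exact fun y => (tendsto_lambda1Bdry hα hε y).comp hv'

lemma norm_lambda1Bdry_le (hα : 0 < α) (hε : 0 < ε) (ξ : ℝ) :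
    ‖lambda1Bdry α c ε ξ‖ ≤ √(max (1 / α) (|c| / ε)) := by
  refine le_of_tendsto (tendsto_lambda1Bdry hα hε ξ).norm ?_
  filter_upwards [self_mem_nhdsWithin] with η hη
  exact norm_lambda1_le hα hε (by simpa using hη)

/-- `λ₁(s) = -1/√α + O(1/s)`: the product `s (λ₁(s) + 1/√α)` is bounded. -/
lemma norm_mul_lambda1_add_le (hα : 0 < α) (hε : 0 < ε) {s : ℂ} (hs : 0 < s.re) :
    ‖s * (lambda1 α c ε s + ((1 / √α : ℝ) : ℂ))‖
      ≤ (|c| + ε * max (1 / α) (|c| / ε)) / α := by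
  obtain ⟨h0, hneg⟩ := lambda1_spec (c := c) hα hε hs
  have hb := normSq_le_of_charPoly_eq_zero hα hε hs h0 hneg
  set z := lambda1 α c ε s
  set a : ℝ := 1 / √α with ha
  have ha0 : 0 < a := by positivity
  have haα : α * a ^ 2 = 1 := by
    rw [ha, div_pow, Real.sq_sqrt hα.le]; field_simp
  have haα' : (α : ℂ) * (a : ℂ) ^ 2 = 1 := by exact_mod_cast haα
  have e : (α : ℂ) * (s * (z + a)) * (a - z) = - z * (c + ε * z ^ 2) := by
    unfold charPoly at h0; linear_combination h0 + s * haα'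
  have h1 : ‖z‖ ≤ ‖(a : ℂ) - z‖ := by
    refine (sq_le_sq₀ (norm_nonneg _) (norm_nonneg _)).1 ?_
    rw [← Complex.normSq_eq_norm_sq, ← Complex.normSq_eq_norm_sq, Complex.normSq_apply,
      Complex.normSq_apply]
    simp
    nlinarith
  have h2 : 0 < ‖(a : ℂ) - z‖ := by
    rw [norm_pos_iff]
    intro h
    have := congrArg Complex.re h
    simp at this
    linarith
  have h3 := congrArg norm e
  rw [norm_mul, norm_mul, Complex.norm_real, Real.norm_of_nonneg hα.le, norm_mul (-z), norm_neg]
    at h3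
  have h4 : ‖(c : ℂ) + ε * z ^ 2‖ ≤ |c| + ε * max (1 / α) (|c| / ε) := by
    refine (norm_add_le _ _).trans ?_
    rw [norm_mul, Complex.norm_real, Complex.norm_real, norm_pow, Real.norm_of_nonneg hε.le,
      Real.norm_eq_abs]
    gcongr
  rw [le_div_iff₀ hα]
  refine le_of_mul_le_mul_right ?_ h2
  calc ‖s * (z + a)‖ * α * ‖(a : ℂ) - z‖ = ‖z‖ * ‖(c : ℂ) + ε * z ^ 2‖ := by rw [← h3]; ring
    _ ≤ ‖(a : ℂ) - z‖ * (|c| + ε * max (1 / α) (|c| / ε)) := by gcongr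
    _ = _ := by ring

lemma norm_mul_lambda1Bdry_add_le (hα : 0 < α) (hε : 0 < ε) (ξ : ℝ) :
    ‖(ξ : ℂ) * Complex.I * (lambda1Bdry α c ε ξ + ((1 / √α : ℝ) : ℂ))‖
      ≤ (|c| + ε * max (1 / α) (|c| / ε)) / α := by
  refine le_of_tendsto
    ((tendsto_line ξ).mul ((tendsto_lambda1Bdry hα hε ξ).add tendsto_const_nhds)).norm ?_
  filter_upwards [self_mem_nhdsWithin] with η hη
  exact norm_mul_lambda1_add_le hα hε (by simpa using hη)

end Roots

/-! ### Plancherel theorem for Fourier integrals -/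

section Plancherel

lemma continuous_fourier_of_integrable {g : ℝ → ℂ} (hg : Integrable g) : Continuous (𝓕 g) :=
  VectorFourier.fourierIntegral_continuous Real.continuous_fourierChar
    (by exact continuous_inner) hg

/-- The `L²` Fourier transform of a function in `L¹ ∩ L²` is the Fourier integral. -/
lemma coeFn_fourier_toLp {g : ℝ → ℂ} (hg : Integrable g) (hg2 : MemLp g 2) :
    ⇑(𝓕 (hg2.toLp g) : Lp ℂ 2 (volume : Measure ℝ)) =ᵐ[volume] 𝓕 g := by
  refine ae_eq_of_integral_contDiff_smul_eq ?_ ?_ ?_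
  · exact (Lp.memLp _).locallyIntegrable (by norm_num)
  · exact (continuous_fourier_of_integrable hg).locallyIntegrable
  · intro ψ hψ hψc
    have hψ' : ContDiff ℝ ∞ fun x => (ψ x : ℂ) := Complex.ofRealCLM.contDiff.comp hψ
    have hψc' : HasCompactSupport fun x => (ψ x : ℂ) :=
      hψc.comp_left (g := ((↑) : ℝ → ℂ)) Complex.ofReal_zero
    set Ψ : SchwartzMap ℝ ℂ := hψc'.toSchwartzMap hψ' with hΨ
    have h1 := congrArg (fun D => D Ψ) (Lp.fourier_toTemperedDistribution_eq (hg2.toLp g))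
    simp only [TemperedDistribution.fourier_apply, Lp.toTemperedDistribution_apply] at h1
    have h2 : ∫ x, (𝓕 Ψ) x • (hg2.toLp g) x = ∫ x, (𝓕 Ψ) x • g x := by
      refine integral_congr_ae ?_
      filter_upwards [hg2.coeFn_toLp] with x hx
      rw [hx]
    have h3 : ∫ x, (𝓕 Ψ) x • g x = ∫ x, Ψ x • 𝓕 g x := by
      have := VectorFourier.integral_fourierIntegral_smul_eq_flip (μ := volume) (ν := volume)
        (L := innerₗ ℝ) Real.continuous_fourierChar continuous_inner Ψ.integrable hg
      rw [flip_innerₗ] at this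
      exact this
    simp only [← Complex.coe_smul]
    change ∫ x, Ψ x • _ = ∫ x, Ψ x • _
    rw [← h3, ← h2, h1]

lemma memLp_fourier {g : ℝ → ℂ} (hg : Integrable g) (hg2 : MemLp g 2) : MemLp (𝓕 g) 2 :=
  (memLp_congr_ae (coeFn_fourier_toLp hg hg2)).1 (Lp.memLp _)

/-- Every `F ∈ L²` is the Fourier transform of some `f ∈ L²`. The relation between `f` and `F` is
expressed by Parseval's formula against functions in `L¹ ∩ L²`, so that only Fourier integrals
occur. -/
lemma exists_inverse_fourier {F : ℝ → ℂ} (hF : MemLp F 2) :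
    ∃ f : ℝ → ℂ, MemLp f 2 ∧ (∀ h : ℝ → ℂ, Integrable h → MemLp h 2 →
      ∫ x, f x * conj (h x) = ∫ ξ, F ξ * conj (𝓕 h ξ)) ∧ ∫ x, ‖f x‖ ^ 2 = ∫ ξ, ‖F ξ‖ ^ 2 := by
  set f : Lp ℂ 2 (volume : Measure ℝ) := 𝓕⁻ (hF.toLp F) with hf
  have hfF : 𝓕 f = hF.toLp F := FourierTransform.fourier_fourierInv_eq _
  refine ⟨f, Lp.memLp _, fun h h1 h2 => ?_, ?_⟩
  · have e := Lp.inner_fourier_eq (h2.toLp h) f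
    rw [hfF, L2.inner_def, L2.inner_def] at e
    have e1 : ∫ x, inner ℂ ((h2.toLp h) x) (f x) = ∫ x, f x * conj (h x) := by
      refine integral_congr_ae ?_
      filter_upwards [h2.coeFn_toLp] with x hx
      rw [hx]; rfl
    have e2 : ∫ x, inner ℂ ((𝓕 (h2.toLp h) : Lp ℂ 2 (volume : Measure ℝ)) x) ((hF.toLp F) x)
        = ∫ ξ, F ξ * conj (𝓕 h ξ) := by
      refine integral_congr_ae ?_
      filter_upwards [coeFn_fourier_toLp h1 h2, hF.coeFn_toLp] with x hx hx'
      rw [hx, hx']; rfl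
    rw [← e1, ← e2, e]
  · have e := Lp.inner_fourier_eq f f
    rw [hfF, L2.inner_def, L2.inner_def] at e
    have e1 : ∫ x, inner ℂ (f x) (f x) = ((∫ x, ‖f x‖ ^ 2 : ℝ) : ℂ) := by
      rw [← integral_complex_ofReal]
      congr with x
      rw [inner_self_eq_norm_sq_to_K]; simp
    have e2 : ∫ x, inner ℂ ((hF.toLp F) x) ((hF.toLp F) x) = ((∫ x, ‖F x‖ ^ 2 : ℝ) : ℂ) := by
      rw [← integral_complex_ofReal]
      refine integral_congr_ae ?_
      filter_upwards [hF.coeFn_toLp] with x hx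
      rw [hx, inner_self_eq_norm_sq_to_K]; simp
    rw [e1, e2] at e
    exact_mod_cast e.symm

/-- Parseval's formula for Fourier integrals of functions in `L¹ ∩ L²`. -/
lemma integral_mul_conj_fourier {g h : ℝ → ℂ} (hg : Integrable g) (hg2 : MemLp g 2)
    (hh : Integrable h) (hh2 : MemLp h 2) :
    ∫ ξ, 𝓕 g ξ * conj (𝓕 h ξ) = ∫ x, g x * conj (h x) := by
  have e := Lp.inner_fourier_eq (hh2.toLp h) (hg2.toLp g)
  rw [L2.inner_def, L2.inner_def] at e
  have e1 : ∫ x, inner ℂ ((hh2.toLp h) x) ((hg2.toLp g) x) = ∫ x, g x * conj (h x) := by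
    refine integral_congr_ae ?_
    filter_upwards [hh2.coeFn_toLp, hg2.coeFn_toLp] with x hx hx'
    rw [hx, hx']; rfl
  have e2 : ∫ x, inner ℂ ((𝓕 (hh2.toLp h) : Lp ℂ 2 (volume : Measure ℝ)) x)
      ((𝓕 (hg2.toLp g) : Lp ℂ 2 (volume : Measure ℝ)) x)
      = ∫ ξ, 𝓕 g ξ * conj (𝓕 h ξ) := by
    refine integral_congr_ae ?_
    filter_upwards [coeFn_fourier_toLp hg hg2, coeFn_fourier_toLp hh hh2] with x hx hx'
    rw [hx, hx']; rfl
  rw [← e1, ← e2, e]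

end Plancherel

/-! ### Laplace transforms and the limit to the imaginary axis -/

section Laplace

/-- The integral `∫ e^{zt} A(t) dt` over the whole line: the bilateral Laplace transform of `A` at
`-z`. -/
noncomputable def expIntegral (A : ℝ → ℂ) (z : ℂ) : ℂ := ∫ t : ℝ, Complex.exp (z * t) * A t

/-- The complex-valued function equal to `g` on `(0, T]` and to `0` elsewhere. -/
noncomputable def cutoff (T : ℝ) (g : ℝ → ℝ) : ℝ → ℂ := (Ioc 0 T).indicator fun t => (g t : ℂ)

lemma cutoff_eq_zero {T : ℝ} {g : ℝ → ℝ} {t : ℝ} (ht : t ∉ Icc 0 T) : cutoff T g t = 0 :=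
  indicator_of_notMem (fun h => ht (Ioc_subset_Icc_self h)) _

lemma cutoff_apply {T : ℝ} {g : ℝ → ℝ} {t : ℝ} (ht : t ∈ Ioc 0 T) : cutoff T g t = g t :=
  indicator_of_mem ht _

lemma memLp_cutoff {T : ℝ} {g : ℝ → ℝ} (hg : ContinuousOn g (Icc 0 T)) (p : ENNReal) :
    MemLp (cutoff T g) p := by
  refine (memLp_indicator_iff_restrict measurableSet_Ioc).2 ?_
  have hg' : ContinuousOn (fun t => (g t : ℂ)) (Icc 0 T) :=
    Complex.continuous_ofReal.comp_continuousOn hg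
  obtain ⟨C, hC⟩ := isCompact_Icc.exists_bound_of_continuousOn hg'
  refine MemLp.of_bound ((hg'.mono Ioc_subset_Icc_self).aestronglyMeasurable measurableSet_Ioc)
    C ?_
  exact ae_restrict_of_forall_mem measurableSet_Ioc fun t ht => hC t (Ioc_subset_Icc_self ht)

lemma integrable_cutoff {T : ℝ} {g : ℝ → ℝ} (hg : ContinuousOn g (Icc 0 T)) :
    Integrable (cutoff T g) := memLp_one_iff_integrable.1 (memLp_cutoff hg 1)

lemma norm_exp_mul_le {T : ℝ} {A : ℝ → ℂ} (h0 : ∀ t ∉ Icc 0 T, A t = 0) (z : ℂ) (t : ℝ) :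
    ‖Complex.exp (z * t) * A t‖ ≤ Real.exp (|z.re| * T) * ‖A t‖ := by
  by_cases ht : t ∈ Icc 0 T
  · rw [norm_mul, Complex.norm_exp, Complex.re_mul_ofReal]
    refine mul_le_mul_of_nonneg_right (Real.exp_le_exp.2 ?_) (norm_nonneg _)
    calc z.re * t ≤ |z.re| * t := mul_le_mul_of_nonneg_right (le_abs_self _) ht.1
      _ ≤ |z.re| * T := mul_le_mul_of_nonneg_left ht.2 (abs_nonneg _)
  · simp [h0 t ht]

lemma integrable_exp_mul {T : ℝ} {A : ℝ → ℂ} (hA : Integrable A)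
    (h0 : ∀ t ∉ Icc 0 T, A t = 0) (z : ℂ) :
    Integrable fun t : ℝ => Complex.exp (z * t) * A t :=
  (hA.norm.const_mul (Real.exp (|z.re| * T))).mono'
    ((by fun_prop : Continuous fun t : ℝ => Complex.exp (z * t)).aestronglyMeasurable.mul hA.1)
    (Eventually.of_forall (norm_exp_mul_le h0 z))

lemma norm_expIntegral_le {T : ℝ} {A : ℝ → ℂ} (hA : Integrable A)
    (h0 : ∀ t ∉ Icc 0 T, A t = 0) (z : ℂ) :
    ‖expIntegral A z‖ ≤ Real.exp (|z.re| * T) * ∫ t, ‖A t‖ := by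
  unfold expIntegral
  rw [← integral_const_mul]
  exact norm_integral_le_of_norm_le (hA.norm.const_mul _)
    (Eventually.of_forall (norm_exp_mul_le h0 z))

lemma continuous_expIntegral {T : ℝ} {A : ℝ → ℂ} (hA : Integrable A)
    (h0 : ∀ t ∉ Icc 0 T, A t = 0) : Continuous (expIntegral A) := by
  rw [continuous_iff_continuousAt]
  intro z
  have hev : ∀ᶠ w : ℂ in 𝓝 z, |w.re| ≤ |z.re| + 1 :=
    ((Complex.continuous_re.abs.tendsto z).eventually (gt_mem_nhds (lt_add_one _))).mono
      fun _ h => le_of_lt h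
  refine continuousAt_of_dominated (bound := fun t => Real.exp ((|z.re| + 1) * |T|) * ‖A t‖)
    (Eventually.of_forall fun w => (integrable_exp_mul hA h0 w).1) ?_ (hA.norm.const_mul _) ?_
  · filter_upwards [hev] with w hw
    refine Eventually.of_forall fun t => (norm_exp_mul_le h0 w t).trans ?_
    refine mul_le_mul_of_nonneg_right (Real.exp_le_exp.2 ?_) (norm_nonneg _)
    exact (mul_le_mul_of_nonneg_left (le_abs_self T) (abs_nonneg _)).trans
      (mul_le_mul_of_nonneg_right hw (abs_nonneg _))
  · exact Eventually.of_forall fun t => Continuous.continuousAt (by fun_prop)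

lemma expIntegral_neg_two_pi_mul (A : ℝ → ℂ) (ξ : ℝ) :
    expIntegral A (-((2 * Real.pi * ξ : ℝ) * Complex.I)) = 𝓕 A ξ := by
  rw [Real.fourier_real_eq_integral_exp_smul]
  unfold expIntegral
  congr with t
  rw [smul_eq_mul]
  congr 2
  push_cast
  ring

lemma expIntegral_two_pi_mul (φ : ℝ → ℝ) (ξ : ℝ) :
    expIntegral (fun t => (φ t : ℂ)) ((2 * Real.pi * ξ : ℝ) * Complex.I)
      = conj (𝓕 (fun t => (φ t : ℂ)) ξ) := by
  rw [← expIntegral_neg_two_pi_mul]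
  unfold expIntegral
  rw [← integral_conj]
  congr with t
  simp only [map_mul, ← Complex.exp_conj, map_neg, Complex.conj_ofReal, Complex.conj_I]
  congr 2
  ring

/-- The Laplace transform takes the convolution in the definition of `invLaplaceConv` to a
product. -/
lemma integral_exp_mul_correlation {T : ℝ} (hT : 0 < T) {g φ : ℝ → ℝ}
    (hg : ContinuousOn g (Icc 0 T)) (hφ : Integrable fun t => (φ t : ℂ))
    (hφ0 : ∀ t ∉ Icc 0 T, φ t = 0) (s : ℂ) :
    ∫ τ : ℝ, Complex.exp (s * τ) * ((∫ t in (0 : ℝ)..T, g t * φ (t + τ) : ℝ) : ℂ)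
      = expIntegral (cutoff T g) (-s) * expIntegral (fun t => (φ t : ℂ)) s := by
  set A : ℝ → ℂ := fun t => Complex.exp (-s * (-t : ℝ)) * cutoff T g (-t) with hA
  set B : ℝ → ℂ := fun t => Complex.exp (s * t) * φ t with hB
  have hAi : Integrable A :=
    (integrable_exp_mul (integrable_cutoff hg) (fun t ht => cutoff_eq_zero ht) (-s)).comp_neg
  have hBi : Integrable B := integrable_exp_mul (T := T) hφ (fun t ht => by simp [hφ0 t ht]) s
  have h := integral_convolution (μ := volume) (ν := volume) (ContinuousLinearMap.mul ℂ ℂ) hAi hBi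
  have hA' : ∫ t, A t = expIntegral (cutoff T g) (-s) :=
    integral_neg_eq_self (fun t : ℝ => Complex.exp (-s * t) * cutoff T g t) volume
  rw [ContinuousLinearMap.mul_apply', hA'] at h
  rw [← show ∫ t, B t = expIntegral (fun t => (φ t : ℂ)) s from rfl, ← h]
  congr with τ
  rw [convolution, ← integral_neg_eq_self]
  rw [intervalIntegral.integral_of_le hT.le, ← integral_complex_ofReal,
    ← integral_indicator measurableSet_Ioc, ← integral_const_mul]
  congr with t
  simp only [hA, hB, cutoff, ContinuousLinearMap.mul_apply']
  by_cases ht : t ∈ Ioc 0 T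
  · rw [indicator_of_mem ht, neg_neg, indicator_of_mem ht]
    have : Complex.exp (s * τ) = Complex.exp (-s * t) * Complex.exp (s * ((τ - -t : ℝ) : ℂ)) := by
      rw [← Complex.exp_add]; congr 1; push_cast; ring
    rw [this, show τ - -t = t + τ by ring]
    push_cast
    ring
  · rw [indicator_of_notMem ht, neg_neg, indicator_of_notMem ht]
    ring

lemma IsTest.deriv {T : ℝ} {φ : ℝ → ℝ} (h : IsTest T φ) : IsTest T (deriv φ) :=
  ⟨(contDiff_infty_iff_deriv.1 h.smooth).2, h.compact.deriv,
    fun _ hx => h.supp (tsupport_deriv_subset hx)⟩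

lemma IsTest.eq_zero {T : ℝ} {φ : ℝ → ℝ} (h : IsTest T φ) {t : ℝ} (ht : t ∉ Ioo 0 T) :
    φ t = 0 := image_eq_zero_of_notMem_tsupport fun h' => ht (h.supp h')

lemma IsTest.integrable {T : ℝ} {φ : ℝ → ℝ} (h : IsTest T φ) :
    Integrable fun t => (φ t : ℂ) :=
  (h.smooth.continuous.integrable_of_hasCompactSupport h.compact).ofReal

lemma IsTest.memLp {T : ℝ} {φ : ℝ → ℝ} (h : IsTest T φ) :
    MemLp (fun t => (φ t : ℂ)) 2 :=
  (h.smooth.continuous.memLp_of_hasCompactSupport h.compact).ofReal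

lemma IsTest.ofReal_eq_zero {T : ℝ} {φ : ℝ → ℝ} (h : IsTest T φ) (t : ℝ) (ht : t ∉ Icc 0 T) :
    (φ t : ℂ) = 0 := by
  rw [h.eq_zero fun h' => ht (Ioo_subset_Icc_self h'), Complex.ofReal_zero]

lemma IsTest.hasDerivAt {T : ℝ} {φ : ℝ → ℝ} (h : IsTest T φ) (t : ℝ) :
    HasDerivAt φ (_root_.deriv φ t) t :=
  (h.smooth.differentiable (by simp) t).hasDerivAt

lemma expIntegral_deriv {T : ℝ} {φ : ℝ → ℝ} (h : IsTest T φ) (s : ℂ) :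
    expIntegral (fun t => ((deriv φ t : ℝ) : ℂ)) s = -s * expIntegral (fun t => (φ t : ℂ)) s := by
  unfold expIntegral
  have := integral_mul_deriv_eq_deriv_mul_of_integrable
    (u := fun t : ℝ => Complex.exp (s * t)) (u' := fun t : ℝ => Complex.exp (s * t) * s)
    (v := fun t => (φ t : ℂ)) (v' := fun t => ((deriv φ t : ℝ) : ℂ))
    (fun t _ => by
      have h1 : HasDerivAt (fun t : ℝ => s * (t : ℂ)) (s * 1) t :=
        (Complex.ofRealCLM.hasDerivAt (x := t)).const_mul s
      simpa using h1.cexp)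
    (fun t _ => (h.hasDerivAt t).ofReal_comp)
    (integrable_exp_mul h.deriv.integrable h.deriv.ofReal_eq_zero s)
    (by
      have := (integrable_exp_mul h.integrable h.ofReal_eq_zero s).const_mul s
      refine this.congr (Eventually.of_forall fun t => ?_)
      simp only [Pi.mul_apply]; ring)
    (integrable_exp_mul h.integrable h.ofReal_eq_zero s)
  rw [this, ← integral_const_mul, ← integral_neg]
  congr with t
  ring

/-- The Laplace transform of a test function decays rapidly on the strip `0 ≤ Re s ≤ 1`. -/
lemma exists_pow_mul_expIntegral_le {T : ℝ} (hT : 0 < T) (k : ℕ) : ∀ {φ : ℝ → ℝ}, IsTest T φ →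
    ∃ K, ∀ s : ℂ, 0 ≤ s.re → s.re ≤ 1 →
      ‖s‖ ^ k * ‖expIntegral (fun t => (φ t : ℂ)) s‖ ≤ K := by
  induction k with
  | zero =>
    intro φ h
    refine ⟨Real.exp T * ∫ t, ‖(φ t : ℂ)‖, fun s h0 h1 => ?_⟩
    rw [pow_zero, one_mul]
    refine (norm_expIntegral_le h.integrable h.ofReal_eq_zero s).trans ?_
    refine mul_le_mul_of_nonneg_right ?_ (integral_nonneg fun _ => norm_nonneg _)
    rw [abs_of_nonneg h0]
    exact Real.exp_le_exp.2 (by nlinarith)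
  | succ k ih =>
    intro φ h
    obtain ⟨K, hK⟩ := ih h.deriv
    refine ⟨K, fun s h0 h1 => ?_⟩
    have := hK s h0 h1
    rwa [expIntegral_deriv h, norm_mul, norm_neg, ← mul_assoc, ← pow_succ] at this

/-- The Fourier side of the pairing of `𝓛⁻¹(F) ∗ g` with `φ`, where `m` holds the boundary values of
`F` on the imaginary axis, at frequency `ξ` (that is, at `s = 2πiξ`). -/
noncomputable def pairing (T : ℝ) (m : ℝ → ℂ) (g φ : ℝ → ℝ) : ℂ :=
  ∫ ξ, m ξ * 𝓕 (cutoff T g) ξ * conj (𝓕 (fun t => (φ t : ℂ)) ξ)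

/-- The contour of the Bromwich integral may be moved to the imaginary axis. -/
lemma tendsto_invLaplaceConv {T : ℝ} (hT : 0 < T) {F : ℂ → ℂ} {F₀ : ℝ → ℂ} {C : ℝ}
    (hFm : ∀ σ : ℝ, 0 < σ → Measurable fun y : ℝ => F ((σ : ℂ) + (y : ℂ) * Complex.I))
    (hFC : ∀ s : ℂ, 0 < s.re → ‖F s‖ ≤ C * (1 + ‖s‖))
    (hF₀ : ∀ y : ℝ, Tendsto (fun σ : ℝ => F ((σ : ℂ) + (y : ℂ) * Complex.I)) (𝓝[>] (0 : ℝ))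
      (𝓝 (F₀ y)))
    {g φ : ℝ → ℝ} (hg : ContinuousOn g (Icc 0 T)) (hφ : IsTest T φ) :
    Tendsto (fun σ : ℝ => invLaplaceConv σ F T g φ) (𝓝[>] (0 : ℝ))
      (𝓝 (pairing T (fun ξ => F₀ (2 * Real.pi * ξ)) g φ)) := by
  set G := expIntegral (cutoff T g)
  set Φ := expIntegral (fun t => (φ t : ℂ))
  have hGc : Continuous G := continuous_expIntegral (integrable_cutoff hg)
    (fun t ht => cutoff_eq_zero ht)
  have hΦc : Continuous Φ := continuous_expIntegral hφ.integrable hφ.ofReal_eq_zero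
  have hform : ∀ σ : ℝ, invLaplaceConv σ F T g φ = (1 / (2 * (Real.pi : ℂ))) *
      ∫ y : ℝ, F ((σ : ℂ) + (y : ℂ) * Complex.I) *
        (G (-((σ : ℂ) + (y : ℂ) * Complex.I)) * Φ ((σ : ℂ) + (y : ℂ) * Complex.I)) := by
    intro σ
    unfold invLaplaceConv invLaplace
    congr 2
    funext y
    rw [integral_exp_mul_correlation hT hg hφ.integrable
      (fun t ht => hφ.eq_zero fun h => ht (Ioo_subset_Icc_self h))]
  have hlim : pairing T (fun ξ => F₀ (2 * Real.pi * ξ)) g φ = (1 / (2 * (Real.pi : ℂ))) *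
      ∫ y : ℝ, F₀ y * (G (-((y : ℂ) * Complex.I)) * Φ ((y : ℂ) * Complex.I)) := by
    have := Measure.integral_comp_mul_left
      (fun y : ℝ => F₀ y * (G (-((y : ℂ) * Complex.I)) * Φ ((y : ℂ) * Complex.I))) (2 * Real.pi)
    rw [abs_of_pos (by positivity)] at this
    rw [show (1 / (2 * (Real.pi : ℂ))) = (((2 * Real.pi)⁻¹ : ℝ) : ℂ) by push_cast; simp,
      ← Complex.real_smul, ← this]
    unfold pairing
    congr with ξ
    simp only [G, Φ]
    rw [expIntegral_neg_two_pi_mul, expIntegral_two_pi_mul, mul_assoc]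
  obtain ⟨K₀, hK₀⟩ := exists_pow_mul_expIntegral_le hT 0 hφ
  obtain ⟨K₃, hK₃⟩ := exists_pow_mul_expIntegral_le hT 3 hφ
  set M := Real.exp T * ∫ t, ‖cutoff T g t‖ with hM
  have hGM : ∀ s : ℂ, 0 ≤ s.re → s.re ≤ 1 → ‖G (-s)‖ ≤ M := by
    intro s h0 h1
    refine (norm_expIntegral_le (integrable_cutoff hg) (fun t ht => cutoff_eq_zero ht) _).trans ?_
    refine mul_le_mul_of_nonneg_right ?_ (integral_nonneg fun _ => norm_nonneg _)
    rw [Complex.neg_re, abs_neg, abs_of_nonneg h0]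
    exact Real.exp_le_exp.2 (by nlinarith)
  have hC0 : 0 ≤ C := by
    have := (norm_nonneg _).trans (hFC 1 (by simp))
    simp at this; linarith
  rw [hlim]
  simp_rw [hform]
  refine Tendsto.const_mul _ ?_
  have hmem : ∀ᶠ σ : ℝ in 𝓝[>] (0 : ℝ), σ ∈ Ioo (0 : ℝ) 1 := Ioo_mem_nhdsGT one_pos
  refine tendsto_integral_filter_of_dominated_convergence
    (fun y => C * M * (2 * (K₀ + K₃)) * (1 + y ^ 2)⁻¹) ?_ ?_
    (integrable_inv_one_add_sq.const_mul _) ?_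
  · filter_upwards [hmem] with σ hσ
    exact ((hFm σ hσ.1).mul (Continuous.measurable (by fun_prop))).aestronglyMeasurable
  · filter_upwards [hmem] with σ hσ
    refine Eventually.of_forall fun y => ?_
    set s : ℂ := (σ : ℂ) + (y : ℂ) * Complex.I with hs
    have hre : s.re = σ := by simp [hs]
    have him : s.im = y := by simp [hs]
    have h0 : 0 ≤ s.re := hre ▸ hσ.1.le
    have h1 : s.re ≤ 1 := hre ▸ hσ.2.le
    have hy : y ^ 2 ≤ ‖s‖ ^ 2 := by
      rw [← him, ← sq_abs s.im]
      exact pow_le_pow_left₀ (abs_nonneg _) (Complex.abs_im_le_norm s) 2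
    have k0 := hK₀ s h0 h1
    have k3 := hK₃ s h0 h1
    have kG := hGM s h0 h1
    have kF := hFC s (hre ▸ hσ.1)
    -- `(1 + x) (1 + x²) ≤ 2 (1 + x³)`
    have kΦ : (1 + ‖s‖) * ‖Φ s‖ ≤ 2 * (K₀ + K₃) * (1 + y ^ 2)⁻¹ := by
      rw [← div_eq_mul_inv, le_div_iff₀ (by positivity)]
      have hn : 0 ≤ ‖s‖ := norm_nonneg s
      have h2 : (1 + ‖s‖) * (1 + y ^ 2) ≤ 2 * (1 + ‖s‖ ^ 3) := by
        have : (1 + ‖s‖) * (1 + y ^ 2) ≤ (1 + ‖s‖) * (1 + ‖s‖ ^ 2) := by gcongr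
        nlinarith [mul_nonneg (by linarith : 0 ≤ 1 + ‖s‖) (sq_nonneg (1 - ‖s‖))]
      have := mul_le_mul_of_nonneg_right h2 (norm_nonneg (Φ s))
      simp only [pow_zero, one_mul] at k0
      change ‖Φ s‖ ≤ _ at k0
      change ‖s‖ ^ 3 * ‖Φ s‖ ≤ _ at k3
      nlinarith
    rw [norm_mul, norm_mul]
    have hM0 : 0 ≤ M := (norm_nonneg _).trans kG
    calc ‖F s‖ * (‖G (-s)‖ * ‖Φ s‖) ≤ (C * (1 + ‖s‖)) * (M * ‖Φ s‖) := by gcongr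
      _ = C * M * ((1 + ‖s‖) * ‖Φ s‖) := by ring
      _ ≤ C * M * (2 * (K₀ + K₃) * (1 + y ^ 2)⁻¹) := by gcongr
      _ = _ := by ring
  · refine Eventually.of_forall fun y => (hF₀ y).mul ?_
    have hc : Continuous fun σ : ℝ => G (-((σ : ℂ) + (y : ℂ) * Complex.I))
        * Φ ((σ : ℂ) + (y : ℂ) * Complex.I) := by fun_prop
    have := (hc.tendsto 0).mono_left (nhdsWithin_le_nhds (s := Ioi 0))
    simpa using this

end Laplace

/-! ### Parseval's formula for test functions on `(0, T)` -/

section Pairing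

variable {T : ℝ}

lemma IsTest.integrable_mul {φ w : ℝ → ℝ} (h : IsTest T φ) (hw : ContinuousOn w (Ioi 0)) :
    Integrable fun t => w t * φ t := by
  have hsub : tsupport φ ⊆ Ioi 0 := h.supp.trans Ioo_subset_Ioi_self
  refine (integrableOn_iff_integrable_of_support_subset (s := tsupport φ) ?_).1 ?_
  · exact (Function.support_mul_subset_right w φ).trans (subset_tsupport φ)
  · exact ((hw.mono hsub).mul h.smooth.continuous.continuousOn).integrableOn_compact h.compact

lemma IsTest.intervalIntegral_mul {φ : ℝ → ℝ} (h : IsTest T φ) (hT : 0 < T) (w : ℝ → ℝ) :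
    ∫ t in (0 : ℝ)..T, w t * φ t = ∫ t, w t * φ t := by
  rw [intervalIntegral.integral_of_le hT.le]
  refine setIntegral_eq_integral_of_forall_compl_eq_zero fun t ht => ?_
  rw [h.eq_zero fun h' => ht (Ioo_subset_Ioc_self h'), mul_zero]

lemma IsTest.integral_mul_deriv {φ w w' : ℝ → ℝ} (h : IsTest T φ) (hT : 0 < T)
    (hw : ∀ t, 0 < t → HasDerivAt w (w' t) t) (hw' : ContinuousOn w' (Ioi 0)) :
    ∫ t in (0 : ℝ)..T, w t * _root_.deriv φ t = -∫ t in (0 : ℝ)..T, w' t * φ t := by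
  have hwc : ContinuousOn w (Ioi 0) := fun t ht => (hw t ht).continuousAt.continuousWithinAt
  rw [h.deriv.intervalIntegral_mul hT, h.intervalIntegral_mul hT]
  exact integral_mul_deriv_eq_deriv_mul_of_integrable
    (fun t ht => hw t (h.supp ht).1) (fun t _ => h.hasDerivAt t)
    (h.deriv.integrable_mul hwc) (h.integrable_mul hw') (h.integrable_mul hwc)

lemma memLp_mul_of_bound {m G : ℝ → ℂ} (hm : Measurable m) {C : ℝ} (hC : ∀ ξ, ‖m ξ‖ ≤ C)
    (hG : MemLp G 2) : MemLp (fun ξ => m ξ * G ξ) 2 := by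
  refine hG.of_le_mul (c := C) (hm.aestronglyMeasurable.mul hG.1)
    (Eventually.of_forall fun ξ => ?_)
  rw [norm_mul]
  exact mul_le_mul_of_nonneg_right (hC ξ) (norm_nonneg _)

lemma memLp_conj {G : ℝ → ℂ} (hG : MemLp G 2) : MemLp (fun ξ => conj (G ξ)) 2 :=
  hG.of_le (Complex.continuous_conj.comp_aestronglyMeasurable hG.1) (by simp)

lemma integrable_mul_conj {F G : ℝ → ℂ} (hF : MemLp F 2) (hG : MemLp G 2) :
    Integrable fun ξ => F ξ * conj (G ξ) :=
  hF.integrable_mul (memLp_conj hG)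

lemma IsTest.fourier_deriv {φ : ℝ → ℝ} (h : IsTest T φ) (ξ : ℝ) :
    conj (𝓕 (fun t => ((_root_.deriv φ t : ℝ) : ℂ)) ξ)
      = -(((2 * Real.pi * ξ : ℝ) * Complex.I) * conj (𝓕 (fun t => (φ t : ℂ)) ξ)) := by
  rw [← expIntegral_two_pi_mul, ← expIntegral_two_pi_mul, expIntegral_deriv h, neg_mul]

variable {g φ : ℝ → ℝ}

lemma memLp_fourier_cutoff (hg : ContinuousOn g (Icc 0 T)) : MemLp (𝓕 (cutoff T g)) 2 :=
  memLp_fourier (integrable_cutoff hg) (memLp_cutoff hg 2)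

lemma IsTest.memLp_fourier (h : IsTest T φ) : MemLp (𝓕 (fun t => (φ t : ℂ))) 2 :=
  KdVBBM.memLp_fourier h.integrable h.memLp

lemma integrable_pairing {m : ℝ → ℂ} (hm : Measurable m) {C : ℝ} (hC : ∀ ξ, ‖m ξ‖ ≤ C)
    (hg : ContinuousOn g (Icc 0 T)) (h : IsTest T φ) :
    Integrable fun ξ => m ξ * 𝓕 (cutoff T g) ξ * conj (𝓕 (fun t => (φ t : ℂ)) ξ) :=
  integrable_mul_conj (memLp_mul_of_bound hm hC (memLp_fourier_cutoff hg)) h.memLp_fourier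

/-- A factor `s = 2πiξ` in the multiplier becomes a derivative of the test function. -/
lemma pairing_add_freq_mul {m k : ℝ → ℂ} (hm : Measurable m) {C : ℝ} (hC : ∀ ξ, ‖m ξ‖ ≤ C)
    (hk : Measurable k) {C' : ℝ} (hC' : ∀ ξ, ‖k ξ‖ ≤ C')
    (hg : ContinuousOn g (Icc 0 T)) (h : IsTest T φ) :
    pairing T (fun ξ => m ξ + ((2 * Real.pi * ξ : ℝ) * Complex.I) * k ξ) g φ
      = pairing T m g φ - pairing T k g (deriv φ) := by
  unfold pairing
  rw [← integral_sub (integrable_pairing hm hC hg h) (integrable_pairing hk hC' hg h.deriv)]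
  congr with ξ
  rw [h.fourier_deriv]
  ring

lemma pairing_const (hT : 0 < T) (k : ℂ) (hg : ContinuousOn g (Icc 0 T)) (h : IsTest T φ) :
    pairing T (fun _ => k) g φ = k * ((∫ t in (0 : ℝ)..T, g t * φ t : ℝ) : ℂ) := by
  unfold pairing
  simp_rw [mul_assoc]
  rw [integral_const_mul, integral_mul_conj_fourier (integrable_cutoff hg) (memLp_cutoff hg 2)
    h.integrable h.memLp, h.intervalIntegral_mul hT, ← integral_complex_ofReal]
  congr 2
  funext t
  by_cases ht : t ∈ Ioc 0 T
  · rw [cutoff_apply ht]; simp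
  · rw [h.eq_zero fun h' => ht (Ioo_subset_Ioc_self h')]; simp

/-- Parseval's formula on `(0, T)` for a function `h` known there through its action on test
functions: it is square integrable up to `t = 0`, and its products with continuous functions are
given by the Fourier side. -/
lemma weak_parseval (hT : 0 < T) {h : ℝ → ℝ} (hh : ContinuousOn h (Ioi 0)) {F : ℝ → ℂ}
    (hF : MemLp F 2) (hweak : ∀ φ, IsTest T φ →
      ((∫ t in (0 : ℝ)..T, h t * φ t : ℝ) : ℂ) = ∫ ξ, F ξ * conj (𝓕 (fun t => (φ t : ℂ)) ξ)) :
    (IntervalIntegrable (fun t => h t ^ 2) volume 0 T ∧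
      ∫ t in (0 : ℝ)..T, h t ^ 2 ≤ ∫ ξ, ‖F ξ‖ ^ 2) ∧
    ∀ g : ℝ → ℝ, ContinuousOn g (Icc 0 T) →
      IntervalIntegrable (fun t => g t * h t) volume 0 T ∧
      ∫ t in (0 : ℝ)..T, g t * h t = ∫ ξ, (F ξ * conj (𝓕 (cutoff T g) ξ)).re := by
  obtain ⟨f, hf2, hf, hfn⟩ := exists_inverse_fourier hF
  have hae : ∀ᵐ t, t ∈ Ioo 0 T → (h t : ℂ) = f t := by
    have := isOpen_Ioo.ae_eq_zero_of_integral_contDiff_smul_eq_zero (μ := volume)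
      (U := Ioo (0 : ℝ) T) (f := fun t => (h t : ℂ) - f t) ?_ ?_
    · filter_upwards [this] with t ht ht' using sub_eq_zero.1 (ht ht')
    · refine LocallyIntegrableOn.sub ?_
        ((hf2.locallyIntegrable (by norm_num)).locallyIntegrableOn _)
      exact (Complex.continuous_ofReal.comp_continuousOn
        (hh.mono Ioo_subset_Ioi_self)).locallyIntegrableOn measurableSet_Ioo
    · intro φ h1 h2 h3
      have hφ : IsTest T φ := ⟨h1, h2, h3⟩
      have e := hweak φ hφ
      rw [← hf _ hφ.integrable hφ.memLp, hφ.intervalIntegral_mul hT,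
        ← integral_complex_ofReal] at e
      have i1 : Integrable fun t => ((h t * φ t : ℝ) : ℂ) := (hφ.integrable_mul hh).ofReal
      have i2 : Integrable fun t => f t * conj (φ t : ℂ) := integrable_mul_conj hf2 hφ.memLp
      rw [← sub_eq_zero, ← integral_sub i1 i2] at e
      rw [← e]
      congr with t
      rw [Complex.real_smul, Complex.conj_ofReal]
      push_cast
      ring
  have hae' : ∀ᵐ t ∂volume.restrict (Ioc 0 T), (h t : ℂ) = f t := by
    rw [← restrict_Ioo_eq_restrict_Ioc]
    exact (ae_restrict_iff' measurableSet_Ioo).2 hae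
  have hsq : Integrable fun t => ‖f t‖ ^ 2 := (memLp_two_iff_integrable_sq_norm hf2.1).1 hf2
  have hnorm : (fun t => h t ^ 2) =ᵐ[volume.restrict (Ioc 0 T)] fun t => ‖f t‖ ^ 2 := by
    filter_upwards [hae'] with t ht
    rw [← ht, Complex.norm_real, Real.norm_eq_abs, sq_abs]
  refine ⟨⟨?_, ?_⟩, fun g hg => ?_⟩
  · rw [intervalIntegrable_iff_integrableOn_Ioc_of_le hT.le]
    exact (hsq.integrableOn).congr hnorm.symm
  · rw [intervalIntegral.integral_of_le hT.le, integral_congr_ae hnorm, ← hfn]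
    exact setIntegral_le_integral hsq (Eventually.of_forall fun t => by positivity)
  · have e := hf _ (integrable_cutoff hg) (memLp_cutoff hg 2)
    have i1 : Integrable fun t => f t * conj (cutoff T g t) :=
      integrable_mul_conj hf2 (memLp_cutoff hg 2)
    have i2 : Integrable fun ξ => F ξ * conj (𝓕 (cutoff T g) ξ) :=
      integrable_mul_conj hF (memLp_fourier_cutoff hg)
    have hprod : (fun t => (f t * conj (cutoff T g t)).re)
        =ᵐ[volume.restrict (Ioc 0 T)] fun t => g t * h t := by
      filter_upwards [hae', ae_restrict_mem measurableSet_Ioc] with t ht ht'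
      rw [← ht, cutoff_apply ht', Complex.conj_ofReal, ← Complex.ofReal_mul, Complex.ofReal_re,
        mul_comm]
    have i3 : Integrable fun t => (f t * conj (cutoff T g t)).re := i1.re
    refine ⟨?_, ?_⟩
    · rw [intervalIntegrable_iff_integrableOn_Ioc_of_le hT.le]
      exact i3.integrableOn.congr hprod
    · rw [intervalIntegral.integral_of_le hT.le, ← integral_congr_ae hprod,
        setIntegral_eq_integral_of_forall_compl_eq_zero]
      · have e' := congrArg Complex.re e
        have r1 := integral_re i1
        have r2 := integral_re i2
        simp only [RCLike.re_eq_complex_re] at r1 r2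
        rw [r1, r2, e]
      · intro t ht
        simp [cutoff, indicator_of_notMem ht]

end Pairing

/-! ### Dissipativity of the boundary conditions -/

section Boundary

/-- The boundary symbol `l`, as a function of the frequency `ξ` (at `s = 2πiξ`), with its limit `-a`
at infinity and the positivity that makes the boundary terms dissipative. -/
structure IsDissipativeSymbol (α c ε a : ℝ) (l : ℝ → ℂ) : Prop where
  measurable : Measurable l
  bounded : ∃ C, ∀ ξ, ‖l ξ‖ ≤ C
  bounded_remainder : ∃ C, ∀ ξ, ‖((2 * Real.pi * ξ : ℝ) * Complex.I) * (l ξ + a)‖ ≤ C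
  nonneg : ∀ ξ, 0 ≤ c / 2 + ε * ((l ξ ^ 2).re - ‖l ξ‖ ^ 2 / 2)
    - α * (((2 * Real.pi * ξ : ℝ) * Complex.I) * (l ξ + a)).re

/-- The traces `g`, `v`, `q` of `u`, `∂ₓu`, `∂ₓₓu` at one end point, with the time derivatives `g'`,
`v'` of the first two, for a solution that vanishes there at `t = 0`. -/
structure IsTrace (g v q g' v' : ℝ → ℝ) : Prop where
  g_cont : ContinuousOn g (Ici 0)
  v_cont : ContinuousOn v (Ici 0)
  q_cont : ContinuousOn q (Ioi 0)
  g_deriv : ∀ t, 0 < t → HasDerivAt g (g' t) t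
  v_deriv : ∀ t, 0 < t → HasDerivAt v (v' t) t
  g'_cont : ContinuousOn g' (Ioi 0)
  v'_cont : ContinuousOn v' (Ioi 0)
  g_zero : g 0 = 0

/-- The energy flux through an end point. -/
noncomputable def flux (α c ε : ℝ) (g v q v' : ℝ → ℝ) (t : ℝ) : ℝ :=
  c / 2 * g t ^ 2 + ε * (g t * q t - v t ^ 2 / 2) - α * (g t * v' t)

/-- The multiplier `l² - (α/ε) s (l + a)`: what remains of the symbol of `∂ₓₓu - (α/ε) ∂ₜ∂ₓu` once
its unbounded part `(α a/ε) s` is removed. -/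
noncomputable def reducedSymbol (α ε a : ℝ) (l : ℝ → ℂ) (ξ : ℝ) : ℂ :=
  l ξ ^ 2 - ((α / ε : ℝ) : ℂ) * (((2 * Real.pi * ξ : ℝ) * Complex.I) * (l ξ + a))

variable {α c ε a T : ℝ} {l : ℝ → ℂ} {g v q g' v' : ℝ → ℝ}

lemma IsDissipativeSymbol.measurable_remainder (hl : IsDissipativeSymbol α c ε a l) :
    Measurable fun ξ : ℝ => ((2 * Real.pi * ξ : ℝ) * Complex.I) * (l ξ + a) := by
  have := hl.measurable
  fun_prop

lemma IsDissipativeSymbol.measurable_reducedSymbol (hl : IsDissipativeSymbol α c ε a l) :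
    Measurable (reducedSymbol α ε a l) := by
  have := hl.measurable
  unfold reducedSymbol
  fun_prop

lemma IsDissipativeSymbol.bounded_reducedSymbol (hl : IsDissipativeSymbol α c ε a l) :
    ∃ C, ∀ ξ, ‖reducedSymbol α ε a l ξ‖ ≤ C := by
  obtain ⟨C₁, h₁⟩ := hl.bounded
  obtain ⟨C₂, h₂⟩ := hl.bounded_remainder
  refine ⟨C₁ ^ 2 + ‖((α / ε : ℝ) : ℂ)‖ * C₂, fun ξ => ?_⟩
  refine (norm_sub_le _ _).trans ?_
  rw [norm_pow, norm_mul]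
  gcongr
  · exact h₁ ξ
  · exact h₂ ξ

lemma IsTrace.g_contOn (h : IsTrace g v q g' v') : ContinuousOn g (Icc 0 T) :=
  h.g_cont.mono Icc_subset_Ici_self

lemma IsTrace.v_contOn (h : IsTrace g v q g' v') : ContinuousOn v (Icc 0 T) :=
  h.v_cont.mono Icc_subset_Ici_self

/-- The singular part `g g'` of the flux is an exact derivative, and the rest is integrable up to
`t = 0`. -/
lemma tendsto_integral_flux (hT : 0 < T) (h : IsTrace g v q g' v') {B w : ℝ → ℝ} {k : ℝ}
    (hw : IntervalIntegrable w volume 0 T) (hB : ∀ t, B t = w t + k * (g t * g' t)) :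
    Tendsto (fun δ : ℝ => ∫ t in δ..T, B t) (𝓝[>] (0 : ℝ))
      (𝓝 ((∫ t in (0 : ℝ)..T, w t) + k * (g T ^ 2 / 2))) := by
  have hmem : ∀ᶠ δ : ℝ in 𝓝[>] (0 : ℝ), δ ∈ Ioo (0 : ℝ) T := Ioo_mem_nhdsGT hT
  have h1 : Tendsto (fun δ : ℝ => (∫ t in (0 : ℝ)..T, w t) - ∫ t in (0 : ℝ)..δ, w t)
      (𝓝[>] (0 : ℝ)) (𝓝 ((∫ t in (0 : ℝ)..T, w t) - 0)) := by
    refine tendsto_const_nhds.sub ?_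
    have hc := intervalIntegral.continuousOn_primitive_interval
      (f := w) (μ := volume) (a := 0) (b := T)
      (by rw [uIcc_of_le hT.le, integrableOn_Icc_iff_integrableOn_Ioc]
          exact (intervalIntegrable_iff_integrableOn_Ioc_of_le hT.le).1 hw)
    have := (hc 0 left_mem_uIcc).tendsto
    rw [intervalIntegral.integral_same] at this
    refine this.mono_left ?_
    rw [uIcc_of_le hT.le]
    exact le_trans (by rw [nhdsWithin_Ioc_eq_nhdsGT hT]) (nhdsWithin_mono 0 Ioc_subset_Icc_self)
  have h2 : Tendsto (fun δ : ℝ => k * ((g T ^ 2 - g δ ^ 2) / 2)) (𝓝[>] (0 : ℝ))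
      (𝓝 (k * ((g T ^ 2 - g 0 ^ 2) / 2))) := by
    have : Tendsto g (𝓝[>] (0 : ℝ)) (𝓝 (g 0)) :=
      (h.g_cont 0 self_mem_Ici).tendsto.mono_left (nhdsWithin_mono 0 Ioi_subset_Ici_self)
    exact ((tendsto_const_nhds.sub (this.pow 2)).div_const 2).const_mul k
  have h3 := h1.add h2
  rw [h.g_zero] at h3
  refine (h3.congr' ?_).trans (by simp)
  filter_upwards [hmem] with δ hδ
  have hsub : uIcc δ T ⊆ Ioi 0 := by
    rw [uIcc_of_le hδ.2.le]
    exact fun t ht => hδ.1.trans_le ht.1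
  have hgg : IntervalIntegrable (fun t => g t * g' t) volume δ T :=
    (((h.g_cont.mono Ioi_subset_Ici_self).mul h.g'_cont).mono hsub).intervalIntegrable
  have hwδ : IntervalIntegrable w volume δ T := hw.mono_set (by
    rw [uIcc_of_le hδ.2.le, uIcc_of_le hT.le]; exact Icc_subset_Icc_left hδ.1.le)
  have hw0 : IntervalIntegrable w volume 0 δ := hw.mono_set (by
    rw [uIcc_of_le hδ.1.le, uIcc_of_le hT.le]; exact Icc_subset_Icc_right hδ.2.le)
  have e1 : ∫ t in δ..T, g t * g' t = (g T ^ 2 - g δ ^ 2) / 2 := by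
    have := intervalIntegral.integral_eq_sub_of_hasDerivAt (f := fun t => g t ^ 2 / 2)
      (f' := fun t => g t * g' t) (a := δ) (b := T) (fun t ht => by
        have := ((h.g_deriv t (hsub ht)).pow 2).div_const 2
        refine this.congr_deriv ?_
        simp; ring) hgg
    rw [this]; ring
  simp_rw [hB]
  rw [intervalIntegral.integral_add hwδ (hgg.const_mul k), intervalIntegral.integral_const_mul, e1,
    ← intervalIntegral.integral_add_adjacent_intervals hw0 hwδ]
  ring

lemma integral_sq_eq_fourier (hT : 0 < T) (hg : ContinuousOn g (Icc 0 T)) :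
    ∫ t in (0 : ℝ)..T, g t ^ 2 = ∫ ξ, ‖𝓕 (cutoff T g) ξ‖ ^ 2 := by
  have e := integral_mul_conj_fourier (integrable_cutoff hg) (memLp_cutoff hg 2)
    (integrable_cutoff hg) (memLp_cutoff hg 2)
  simp_rw [Complex.mul_conj, Complex.normSq_eq_norm_sq] at e
  rw [integral_complex_ofReal, integral_complex_ofReal, Complex.ofReal_inj] at e
  rw [e, intervalIntegral.integral_of_le hT.le, ← integral_indicator measurableSet_Ioc]
  congr with t
  by_cases ht : t ∈ Ioc 0 T
  · rw [indicator_of_mem ht, cutoff_apply ht]; simp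
  · rw [indicator_of_notMem ht, cutoff, indicator_of_notMem ht]; simp

lemma integrable_norm_sq_fourier (hg : ContinuousOn g (Icc 0 T)) :
    Integrable fun ξ => ‖𝓕 (cutoff T g) ξ‖ ^ 2 :=
  (memLp_two_iff_integrable_sq_norm (memLp_fourier_cutoff hg).1).1 (memLp_fourier_cutoff hg)

/-- At the right end point the outgoing energy flux is nonnegative. -/
lemma exists_tendsto_flux_right (hα : 0 < α) (hε : 0 < ε) (ha : 0 ≤ a) (hT : 0 < T)
    (hl : IsDissipativeSymbol α c ε a l) (h : IsTrace g v q g' v')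
    (hv : ∀ φ, IsTest T φ → ((∫ t in (0 : ℝ)..T, v t * φ t : ℝ) : ℂ) = pairing T l g φ)
    (hq : ∀ φ, IsTest T φ →
      ((∫ t in (0 : ℝ)..T, q t * φ t : ℝ) : ℂ) = pairing T (fun ξ => l ξ ^ 2) g φ) :
    ∃ L, 0 ≤ L ∧
      Tendsto (fun δ : ℝ => ∫ t in δ..T, flux α c ε g v q v' t) (𝓝[>] (0 : ℝ)) (𝓝 L) := by
  obtain ⟨C, hC⟩ := hl.bounded
  obtain ⟨C', hC'⟩ := hl.bounded_remainder
  obtain ⟨C'', hC''⟩ := hl.bounded_reducedSymbol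
  have hlm := hl.measurable
  have hg := h.g_contOn (T := T)
  have hG := memLp_fourier_cutoff hg
  -- the bounded part of `∂ₓₓu - (α/ε) ∂ₜ∂ₓu`
  set H : ℝ → ℝ := fun t => q t - α / ε * (v' t + a * g' t) with hH
  have hHc : ContinuousOn H (Ioi 0) :=
    h.q_cont.sub (continuousOn_const.mul (h.v'_cont.add (continuousOn_const.mul h.g'_cont)))
  have hHweak : ∀ φ, IsTest T φ → ((∫ t in (0 : ℝ)..T, H t * φ t : ℝ) : ℂ)
      = ∫ ξ, reducedSymbol α ε a l ξ * 𝓕 (cutoff T g) ξ * conj (𝓕 (fun t => (φ t : ℂ)) ξ) := by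
    intro φ hφ
    have e1 : ∫ t in (0 : ℝ)..T, H t * φ t = (∫ t in (0 : ℝ)..T, q t * φ t)
        + α / ε * ((∫ t in (0 : ℝ)..T, v t * deriv φ t)
          + a * ∫ t in (0 : ℝ)..T, g t * deriv φ t) := by
      rw [hφ.integral_mul_deriv hT h.v_deriv h.v'_cont,
        hφ.integral_mul_deriv hT h.g_deriv h.g'_cont]
      simp only [hφ.intervalIntegral_mul hT]
      have i1 := hφ.integrable_mul h.q_cont
      have i2 := hφ.integrable_mul h.v'_cont
      have i3 := hφ.integrable_mul h.g'_cont
      have : ∀ t, H t * φ t = q t * φ t - α / ε * (v' t * φ t + a * (g' t * φ t)) := by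
        intro t; simp only [hH]; ring
      simp_rw [this]
      have i23 : Integrable fun t => v' t * φ t + a * (g' t * φ t) := i2.add (i3.const_mul a)
      rw [integral_sub i1 (i23.const_mul _), integral_const_mul,
        integral_add i2 (i3.const_mul a), integral_const_mul]
      ring
    have e2 : pairing T (fun ξ => ((2 * Real.pi * ξ : ℝ) * Complex.I) * (l ξ + a)) g φ
        = -(pairing T l g (deriv φ) + a * ((∫ t in (0 : ℝ)..T, g t * deriv φ t : ℝ) : ℂ)) := by
      have hb : ∀ ξ, ‖l ξ + (a : ℂ)‖ ≤ C + ‖(a : ℂ)‖ := fun ξ =>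
        (norm_add_le _ _).trans (by gcongr; exact hC ξ)
      have := pairing_add_freq_mul (m := fun _ => 0) (C := 0) measurable_const (by simp)
        (hlm.add_const (a : ℂ)) hb hg hφ
      simp only [zero_add] at this
      rw [this, pairing_const hT 0 hg hφ, zero_mul, zero_sub, ← pairing_const hT a hg hφ.deriv]
      unfold pairing
      rw [← integral_add (integrable_pairing hlm hC hg hφ.deriv)
        (integrable_pairing measurable_const (fun _ => le_rfl) hg hφ.deriv)]
      congr 2
      funext ξ
      ring
    have e3 : ∫ ξ, reducedSymbol α ε a l ξ * 𝓕 (cutoff T g) ξ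
          * conj (𝓕 (fun t => (φ t : ℂ)) ξ)
        = pairing T (fun ξ => l ξ ^ 2) g φ - ((α / ε : ℝ) : ℂ)
          * pairing T (fun ξ => ((2 * Real.pi * ξ : ℝ) * Complex.I) * (l ξ + a)) g φ := by
      unfold pairing
      rw [← integral_const_mul, ← integral_sub
        (integrable_pairing (hlm.pow_const 2) (C := C ^ 2) (fun ξ => by
          rw [norm_pow]; exact pow_le_pow_left₀ (norm_nonneg _) (hC ξ) 2) hg hφ)
        ((integrable_pairing hl.measurable_remainder hC' hg hφ).const_mul _)]
      congr with ξ
      unfold reducedSymbol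
      ring
    rw [e3, e2, e1, ← hq φ hφ, ← hv _ hφ.deriv]
    push_cast
    ring
  obtain ⟨-, hHg⟩ := weak_parseval hT hHc
    (memLp_mul_of_bound hl.measurable_reducedSymbol hC'' hG) hHweak
  obtain ⟨iH, eH⟩ := hHg g hg
  have hlG := memLp_mul_of_bound hlm hC hG
  obtain ⟨⟨iv, ev⟩, -⟩ := weak_parseval hT (h.v_cont.mono Ioi_subset_Ici_self) hlG hv
  have ig : IntervalIntegrable (fun t => g t ^ 2) volume 0 T :=
    ContinuousOn.intervalIntegrable (by rw [uIcc_of_le hT.le]; exact hg.pow 2)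
  have eg := integral_sq_eq_fourier hT hg
  have iw := ((ig.const_mul (c / 2)).add (iH.const_mul ε)).sub (iv.const_mul (ε / 2))
  refine ⟨_, ?_, tendsto_integral_flux hT h (k := α * a) iw fun t => ?_⟩
  · rw [intervalIntegral.integral_sub ((ig.const_mul (c / 2)).add (iH.const_mul ε))
      (iv.const_mul (ε / 2)), intervalIntegral.integral_add (ig.const_mul (c / 2))
      (iH.const_mul ε), intervalIntegral.integral_const_mul, intervalIntegral.integral_const_mul,
      intervalIntegral.integral_const_mul, eg, eH]
    have j1 := integrable_norm_sq_fourier hg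
    have j2 : Integrable fun ξ => (reducedSymbol α ε a l ξ * 𝓕 (cutoff T g) ξ
        * conj (𝓕 (cutoff T g) ξ)).re :=
      (integrable_mul_conj (memLp_mul_of_bound hl.measurable_reducedSymbol hC'' hG) hG).re
    have j3 : Integrable fun ξ => ‖l ξ * 𝓕 (cutoff T g) ξ‖ ^ 2 :=
      (memLp_two_iff_integrable_sq_norm hlG.1).1 hlG
    have key : 0 ≤ ∫ ξ, (c / 2 * ‖𝓕 (cutoff T g) ξ‖ ^ 2
        + ε * (reducedSymbol α ε a l ξ * 𝓕 (cutoff T g) ξ * conj (𝓕 (cutoff T g) ξ)).re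
        - ε / 2 * ‖l ξ * 𝓕 (cutoff T g) ξ‖ ^ 2) := by
      refine integral_nonneg fun ξ => ?_
      have hn := mul_nonneg (hl.nonneg ξ) (sq_nonneg ‖𝓕 (cutoff T g) ξ‖)
      rw [mul_assoc (reducedSymbol _ _ _ _ _), Complex.mul_conj, Complex.normSq_eq_norm_sq,
        Complex.re_mul_ofReal, norm_mul, reducedSymbol, Complex.sub_re, Complex.re_ofReal_mul]
      refine hn.trans_eq ?_
      field_simp
      ring
    have j12 : Integrable fun ξ => c / 2 * ‖𝓕 (cutoff T g) ξ‖ ^ 2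
        + ε * (reducedSymbol α ε a l ξ * 𝓕 (cutoff T g) ξ * conj (𝓕 (cutoff T g) ξ)).re :=
      (j1.const_mul _).add (j2.const_mul _)
    rw [integral_sub j12 (j3.const_mul _), integral_add (j1.const_mul _) (j2.const_mul _),
      integral_const_mul, integral_const_mul, integral_const_mul] at key
    have : 0 ≤ α * a * (g T ^ 2 / 2) := by positivity
    nlinarith [mul_le_mul_of_nonneg_left ev (by positivity : 0 ≤ ε / 2)]
  · simp only [flux, hH]
    field_simp
    ring

/-- At the left end point the incoming energy flux is nonpositive. Here `∂ₓu` and `u` are coupled by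
one condition only, and the square of `v̂ + conj l ĝ` has to be completed. -/
lemma exists_tendsto_flux_left (hα : 0 < α) (hε : 0 < ε) (ha : 0 ≤ a) (hT : 0 < T)
    (hl : IsDissipativeSymbol α c ε a l) (h : IsTrace g v q g' v')
    (hq : ∀ φ, IsTest T φ → ((∫ t in (0 : ℝ)..T, q t * φ t : ℝ) : ℂ)
      + pairing T (fun ξ => l ξ - α * ((2 * Real.pi * ξ : ℝ) * Complex.I) / ε) v φ
      + pairing T (fun ξ => l ξ ^ 2 - α * ((2 * Real.pi * ξ : ℝ) * Complex.I) / ε * l ξ) g φ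
      + ((c / ε * ∫ t in (0 : ℝ)..T, g t * φ t : ℝ) : ℂ) = 0) :
    ∃ L, L ≤ 0 ∧
      Tendsto (fun δ : ℝ => ∫ t in δ..T, flux α c ε g v q v' t) (𝓝[>] (0 : ℝ)) (𝓝 L) := by
  obtain ⟨C, hC⟩ := hl.bounded
  obtain ⟨C'', hC''⟩ := hl.bounded_reducedSymbol
  have hlm := hl.measurable
  have hg := h.g_contOn (T := T)
  have hvc := h.v_contOn (T := T)
  have hG := memLp_fourier_cutoff hg
  have hV := memLp_fourier_cutoff hvc
  set F : ℝ → ℂ := fun ξ => -(l ξ * 𝓕 (cutoff T v) ξ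
    + reducedSymbol α ε a l ξ * 𝓕 (cutoff T g) ξ) with hF
  have hFL : MemLp F 2 := ((memLp_mul_of_bound hlm hC hV).add
    (memLp_mul_of_bound hl.measurable_reducedSymbol hC'' hG)).neg
  -- `∂ₓₓu - (α/ε) ∂ₜ∂ₓu + (c/ε) u` with the unbounded part of its symbol removed
  set H : ℝ → ℝ := fun t => q t - α / ε * v' t + α / ε * a * g' t + c / ε * g t with hH
  have hHc : ContinuousOn H (Ioi 0) :=
    ((h.q_cont.sub (continuousOn_const.mul h.v'_cont)).add
      (continuousOn_const.mul h.g'_cont)).add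
        (continuousOn_const.mul (h.g_cont.mono Ioi_subset_Ici_self))
  have hHweak : ∀ φ, IsTest T φ → ((∫ t in (0 : ℝ)..T, H t * φ t : ℝ) : ℂ)
      = ∫ ξ, F ξ * conj (𝓕 (fun t => (φ t : ℂ)) ξ) := by
    intro φ hφ
    have e1 : ∫ t in (0 : ℝ)..T, H t * φ t = (∫ t in (0 : ℝ)..T, q t * φ t)
        + α / ε * (∫ t in (0 : ℝ)..T, v t * deriv φ t)
        - α / ε * a * (∫ t in (0 : ℝ)..T, g t * deriv φ t)
        + c / ε * ∫ t in (0 : ℝ)..T, g t * φ t := by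
      rw [hφ.integral_mul_deriv hT h.v_deriv h.v'_cont,
        hφ.integral_mul_deriv hT h.g_deriv h.g'_cont]
      simp only [hφ.intervalIntegral_mul hT]
      have i1 := hφ.integrable_mul h.q_cont
      have i2 := hφ.integrable_mul h.v'_cont
      have i3 := hφ.integrable_mul h.g'_cont
      have i4 := hφ.integrable_mul (h.g_cont.mono Ioi_subset_Ici_self)
      have : ∀ t, H t * φ t = q t * φ t - α / ε * (v' t * φ t) + α / ε * a * (g' t * φ t)
          + c / ε * (g t * φ t) := by
        intro t; simp only [hH]; ring
      simp_rw [this]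
      have i12 : Integrable fun t => q t * φ t - α / ε * (v' t * φ t) := i1.sub (i2.const_mul _)
      have i123 : Integrable fun t => q t * φ t - α / ε * (v' t * φ t)
          + α / ε * a * (g' t * φ t) := i12.add (i3.const_mul _)
      rw [integral_add i123 (i4.const_mul _), integral_add i12 (i3.const_mul _),
        integral_sub i1 (i2.const_mul _), integral_const_mul, integral_const_mul,
        integral_const_mul]
      ring
    have e2 : pairing T (fun ξ => l ξ - α * ((2 * Real.pi * ξ : ℝ) * Complex.I) / ε) v φ
        = pairing T l v φ + ((α / ε : ℝ) : ℂ)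
          * ((∫ t in (0 : ℝ)..T, v t * deriv φ t : ℝ) : ℂ) := by
      have := pairing_add_freq_mul (k := fun _ => -((α / ε : ℝ) : ℂ)) hlm hC measurable_const
        (fun _ => le_rfl) hvc hφ
      rw [pairing_const hT _ hvc hφ.deriv] at this
      rw [← sub_neg_eq_add, ← neg_mul, ← this]
      congr 1
      funext ξ
      push_cast
      ring
    have e3 : pairing T
          (fun ξ => l ξ ^ 2 - α * ((2 * Real.pi * ξ : ℝ) * Complex.I) / ε * l ξ) g φ
        = pairing T (reducedSymbol α ε a l) g φ - ((α / ε * a : ℝ) : ℂ)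
          * ((∫ t in (0 : ℝ)..T, g t * deriv φ t : ℝ) : ℂ) := by
      have := pairing_add_freq_mul (k := fun _ => ((α / ε * a : ℝ) : ℂ))
        hl.measurable_reducedSymbol hC'' measurable_const (fun _ => le_rfl) hg hφ
      rw [pairing_const hT _ hg hφ.deriv] at this
      rw [← this]
      congr 1
      funext ξ
      unfold reducedSymbol
      push_cast
      ring
    have e4 : ∫ ξ, F ξ * conj (𝓕 (fun t => (φ t : ℂ)) ξ)
        = -(pairing T l v φ + pairing T (reducedSymbol α ε a l) g φ) := by
      unfold pairing
      rw [← integral_add (integrable_pairing hlm hC hvc hφ)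
        (integrable_pairing hl.measurable_reducedSymbol hC'' hg hφ), ← integral_neg]
      congr with ξ
      simp only [hF]
      ring
    have e5 := hq φ hφ
    rw [e2, e3] at e5
    rw [e4, e1]
    push_cast at e5 ⊢
    linear_combination e5
  obtain ⟨-, hHg⟩ := weak_parseval hT hHc hFL hHweak
  obtain ⟨iH, eH⟩ := hHg g hg
  have ig : IntervalIntegrable (fun t => g t ^ 2) volume 0 T :=
    ContinuousOn.intervalIntegrable (by rw [uIcc_of_le hT.le]; exact hg.pow 2)
  have iv : IntervalIntegrable (fun t => v t ^ 2) volume 0 T :=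
    ContinuousOn.intervalIntegrable (by rw [uIcc_of_le hT.le]; exact hvc.pow 2)
  have eg := integral_sq_eq_fourier hT hg
  have ev := integral_sq_eq_fourier hT hvc
  have iw := ((ig.const_mul (-(c / 2))).add (iH.const_mul ε)).sub (iv.const_mul (ε / 2))
  refine ⟨_, ?_, tendsto_integral_flux hT h (k := -(α * a)) iw fun t => ?_⟩
  · rw [intervalIntegral.integral_sub ((ig.const_mul (-(c / 2))).add (iH.const_mul ε))
      (iv.const_mul (ε / 2)), intervalIntegral.integral_add (ig.const_mul (-(c / 2)))
      (iH.const_mul ε), intervalIntegral.integral_const_mul, intervalIntegral.integral_const_mul,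
      intervalIntegral.integral_const_mul, eg, ev, eH]
    have j1 := integrable_norm_sq_fourier hg
    have j2 : Integrable fun ξ => (F ξ * conj (𝓕 (cutoff T g) ξ)).re :=
      (integrable_mul_conj hFL hG).re
    have j3 := integrable_norm_sq_fourier hvc
    have key : 0 ≤ ∫ ξ, (c / 2 * ‖𝓕 (cutoff T g) ξ‖ ^ 2
        - ε * (F ξ * conj (𝓕 (cutoff T g) ξ)).re
        + ε / 2 * ‖𝓕 (cutoff T v) ξ‖ ^ 2) := by
      refine integral_nonneg fun ξ => ?_
      have hn := mul_nonneg (hl.nonneg ξ) (sq_nonneg ‖𝓕 (cutoff T g) ξ‖)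
      -- the completed square that accounts for the cross term of `v̂` and `ĝ`
      have hs : 0 ≤ ε / 2 * ‖𝓕 (cutoff T v) ξ + conj (l ξ) * 𝓕 (cutoff T g) ξ‖ ^ 2 := by
        positivity
      have e1 : (reducedSymbol α ε a l ξ).re = (l ξ ^ 2).re
          - α / ε * (((2 * Real.pi * ξ : ℝ) * Complex.I) * (l ξ + a)).re := by
        rw [reducedSymbol, Complex.sub_re, Complex.re_ofReal_mul]
      have e2 : (F ξ * conj (𝓕 (cutoff T g) ξ)).re
          = -((l ξ * 𝓕 (cutoff T v) ξ * conj (𝓕 (cutoff T g) ξ)).re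
            + (reducedSymbol α ε a l ξ).re * ‖𝓕 (cutoff T g) ξ‖ ^ 2) := by
        rw [← Complex.re_mul_ofReal, ← Complex.normSq_eq_norm_sq, ← Complex.mul_conj,
          ← Complex.add_re, ← Complex.neg_re]
        congr 1
        simp only [hF]
        ring
      have e3 : ‖𝓕 (cutoff T v) ξ + conj (l ξ) * 𝓕 (cutoff T g) ξ‖ ^ 2
          = ‖𝓕 (cutoff T v) ξ‖ ^ 2 + ‖l ξ‖ ^ 2 * ‖𝓕 (cutoff T g) ξ‖ ^ 2
            + 2 * (l ξ * 𝓕 (cutoff T v) ξ * conj (𝓕 (cutoff T g) ξ)).re := by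
        rw [← Complex.normSq_eq_norm_sq, Complex.normSq_add, Complex.normSq_mul,
          Complex.normSq_conj]
        simp only [Complex.normSq_eq_norm_sq, map_mul, Complex.conj_conj]
        congr 3
        ring
      rw [e3] at hs
      rw [e2, e1]
      have e4 : α / ε * (((2 * Real.pi * ξ : ℝ) * Complex.I) * (l ξ + a)).re * ε
          = α * (((2 * Real.pi * ξ : ℝ) * Complex.I) * (l ξ + a)).re := by
        field_simp
      rw [← e4] at hn
      refine (add_nonneg hn hs).trans_eq ?_
      ring
    have j12 : Integrable fun ξ => c / 2 * ‖𝓕 (cutoff T g) ξ‖ ^ 2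
        - ε * (F ξ * conj (𝓕 (cutoff T g) ξ)).re := (j1.const_mul _).sub (j2.const_mul _)
    rw [integral_add j12 (j3.const_mul _), integral_sub (j1.const_mul _) (j2.const_mul _),
      integral_const_mul, integral_const_mul, integral_const_mul] at key
    have : 0 ≤ α * a * (g T ^ 2 / 2) := by positivity
    linarith
  · simp only [flux, hH]
    field_simp
    ring

end Boundary

/-! ### The energy balance in the interior -/

section Energy

/-- Differentiation under the integral sign, for a time derivative that is continuous on
`(0, ∞) × [a, b]`. -/
lemma hasDerivAt_integral_of_continuousOn {a b : ℝ} (hab : a ≤ b) {f f' : ℝ → ℝ → ℝ}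
    (hf : ∀ τ, 0 < τ → ContinuousOn (f τ) (Icc a b))
    (hd : ∀ τ, 0 < τ → ∀ x ∈ Icc a b, HasDerivAt (fun τ => f τ x) (f' τ x) τ)
    (hc : ContinuousOn (fun p : ℝ × ℝ => f' p.1 p.2) (Ioi 0 ×ˢ Icc a b)) {t : ℝ} (ht : 0 < t) :
    HasDerivAt (fun τ => ∫ x in a..b, f τ x) (∫ x in a..b, f' t x) t := by
  have hK : Icc (t / 2) (2 * t) ×ˢ Icc a b ⊆ Ioi 0 ×ˢ Icc a b :=
    prod_mono (fun τ hτ => lt_of_lt_of_le (by positivity) hτ.1) subset_rfl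
  obtain ⟨C, hC⟩ := (isCompact_Icc.prod isCompact_Icc).exists_bound_of_continuousOn (hc.mono hK)
  have hnhds : Ioo (t / 2) (2 * t) ∈ 𝓝 t := Ioo_mem_nhds (by linarith) (by linarith)
  have hpos : ∀ τ ∈ Ioo (t / 2) (2 * t), 0 < τ := fun τ hτ => lt_trans (by positivity) hτ.1
  have hmeas : ∀ h : ℝ → ℝ, ContinuousOn h (Icc a b) →
      AEStronglyMeasurable h (volume.restrict (uIoc a b)) := by
    intro h hh
    rw [uIoc_of_le hab]
    exact (hh.mono Ioc_subset_Icc_self).aestronglyMeasurable measurableSet_Ioc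
  have hf't : ContinuousOn (f' t) (Icc a b) :=
    hc.comp (f := fun x => (t, x)) (by fun_prop) fun x hx => ⟨ht, hx⟩
  refine (intervalIntegral.hasDerivAt_integral_of_dominated_loc_of_deriv_le
    (bound := fun _ => C) hnhds ?_ ?_ (hmeas _ hf't) ?_ intervalIntegrable_const ?_).2
  · filter_upwards [hnhds] with τ hτ using hmeas _ (hf τ (hpos τ hτ))
  · exact ContinuousOn.intervalIntegrable (by rw [uIcc_of_le hab]; exact hf t ht)
  · refine Eventually.of_forall fun x hx τ hτ => ?_
    rw [uIoc_of_le hab] at hx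
    exact hC (τ, x) ⟨Ioo_subset_Icc_self hτ, Ioc_subset_Icc_self hx⟩
  · refine Eventually.of_forall fun x hx τ hτ => ?_
    rw [uIoc_of_le hab] at hx
    exact hd τ (hpos τ hτ) x (Ioc_subset_Icc_self hx)

variable {xl xr : ℝ} {u : ℝ → ℝ → ℝ}

lemma dX_zero (t x : ℝ) : dX xl xr 0 u t x = u t x := by
  simp [dX]

lemma IsRegular.hasDerivAt_dX (h : IsRegular xl xr u) (hx : xl < xr) {k : ℕ} (hk : k ≤ 2) {t : ℝ}
    (ht : 0 < t) {x : ℝ} (hxI : x ∈ Ioo xl xr) :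
    HasDerivAt (dX xl xr k u t) (dX xl xr (k + 1) u t x) x := by
  have hxI' := Ioo_subset_Icc_self hxI
  have hd := (h.contDiffOn_pos t ht).differentiableOn_iteratedDerivWithin (m := k)
    (by exact_mod_cast (by omega : k < 3)) (uniqueDiffOn_Icc hx) x hxI'
  have := hd.hasDerivWithinAt
  rw [← iteratedDerivWithin_succ] at this
  exact this.hasDerivAt (Icc_mem_nhds hxI.1 hxI.2)

lemma IsRegular.continuousOn_dX (h : IsRegular xl xr u) {k : ℕ} (hk : k ≤ 3) {t : ℝ}
    (ht : 0 < t) : ContinuousOn (dX xl xr k u t) (Icc xl xr) :=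
  (h.continuousOn_pos k hk).comp (f := fun x => (t, x)) (by fun_prop) fun _ hx => ⟨ht, hx⟩

lemma IsRegular.continuousOn_dX_time (h : IsRegular xl xr u) {k : ℕ} (hk : k ≤ 3) {x : ℝ}
    (hx : x ∈ Icc xl xr) : ContinuousOn (fun t => dX xl xr k u t x) (Ioi 0) :=
  (h.continuousOn_pos k hk).comp (f := fun t => (t, x)) (by fun_prop) fun _ ht => ⟨ht, hx⟩

lemma IsRegular.continuousOn_dTdX (h : IsRegular xl xr u) {k : ℕ} (hk : k ≤ 2) {t : ℝ}
    (ht : 0 < t) : ContinuousOn (dTdX xl xr k u t) (Icc xl xr) :=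
  (h.continuousOn_time k hk).comp (f := fun x => (t, x)) (by fun_prop) fun _ hx => ⟨ht, hx⟩

lemma IsRegular.continuousOn_dTdX_time (h : IsRegular xl xr u) {k : ℕ} (hk : k ≤ 2) {x : ℝ}
    (hx : x ∈ Icc xl xr) : ContinuousOn (fun t => dTdX xl xr k u t x) (Ioi 0) :=
  (h.continuousOn_time k hk).comp (f := fun t => (t, x)) (by fun_prop) fun _ ht => ⟨ht, hx⟩

lemma IsRegular.hasDerivAt_time (h : IsRegular xl xr u) {k : ℕ} (hk : k ≤ 2) {t : ℝ}
    (ht : 0 < t) {x : ℝ} (hx : x ∈ Icc xl xr) :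
    HasDerivAt (fun τ => dX xl xr k u τ x) (dTdX xl xr k u t x) t :=
  (h.differentiableAt_time k hk t ht x hx).hasDerivAt

lemma IsRegular.integral_dX (h : IsRegular xl xr u) (hx : xl < xr) {k : ℕ} (hk : k ≤ 2) {t : ℝ}
    (ht : 0 < t) {x : ℝ} (hxI : x ∈ Icc xl xr) :
    ∫ y in xl..x, dX xl xr (k + 1) u t y = dX xl xr k u t x - dX xl xr k u t xl := by
  have hsub : Icc xl x ⊆ Icc xl xr := Icc_subset_Icc_right hxI.2
  refine intervalIntegral.integral_eq_sub_of_hasDerivAt_of_le hxI.1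
    ((h.continuousOn_dX (by omega) ht).mono hsub)
    (fun y hy => h.hasDerivAt_dX hx hk ht ⟨hy.1, hy.2.trans_le hxI.2⟩) ?_
  exact ContinuousOn.intervalIntegrable (by
    rw [uIcc_of_le hxI.1]; exact (h.continuousOn_dX (by omega) ht).mono hsub)

/-- The mixed derivatives commute: `∂ₓ ∂ₜ ∂ₓᵏ u = ∂ₜ ∂ₓᵏ⁺¹ u`. -/
lemma IsRegular.hasDerivAt_dTdX (h : IsRegular xl xr u) (hx : xl < xr) {k : ℕ} (hk : k ≤ 1)
    {t : ℝ} (ht : 0 < t) {x : ℝ} (hxI : x ∈ Ioo xl xr) :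
    HasDerivAt (dTdX xl xr k u t) (dTdX xl xr (k + 1) u t x) x := by
  have hl : xl ∈ Icc xl xr := left_mem_Icc.2 hx.le
  have e : ∀ y ∈ Icc xl xr,
      dTdX xl xr k u t y = dTdX xl xr k u t xl + ∫ z in xl..y, dTdX xl xr (k + 1) u t z := by
    intro y hy
    have hsub : Icc xl y ⊆ Icc xl xr := Icc_subset_Icc_right hy.2
    have h1 := hasDerivAt_integral_of_continuousOn hy.1 (f := fun τ z => dX xl xr (k + 1) u τ z)
      (f' := fun τ z => dTdX xl xr (k + 1) u τ z)
      (fun τ hτ => (h.continuousOn_dX (by omega) hτ).mono hsub)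
      (fun τ hτ z hz => h.hasDerivAt_time (by omega) hτ (hsub hz))
      ((h.continuousOn_time (k + 1) (by omega)).mono (prod_mono subset_rfl hsub)) ht
    have h2 : HasDerivAt (fun τ => dX xl xr k u τ y - dX xl xr k u τ xl)
        (dTdX xl xr k u t y - dTdX xl xr k u t xl) t :=
      (h.hasDerivAt_time (by omega) ht hy).sub (h.hasDerivAt_time (by omega) ht hl)
    have h3 : (fun τ => ∫ z in xl..y, dX xl xr (k + 1) u τ z)
        =ᶠ[𝓝 t] fun τ => dX xl xr k u τ y - dX xl xr k u τ xl := by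
      filter_upwards [lt_mem_nhds ht] with τ hτ using h.integral_dX hx (by omega) hτ hy
    have := (h1.congr_of_eventuallyEq h3.symm).unique h2
    linarith
  have hc := h.continuousOn_dTdX (k := k + 1) (by omega) ht
  have hint : IntervalIntegrable (dTdX xl xr (k + 1) u t) volume xl x :=
    ContinuousOn.intervalIntegrable (by
      rw [uIcc_of_le hxI.1.le]; exact hc.mono (Icc_subset_Icc_right hxI.2.le))
  have hd : HasDerivAt (fun y => dTdX xl xr k u t xl + ∫ z in xl..y, dTdX xl xr (k + 1) u t z)
      (dTdX xl xr (k + 1) u t x) x := by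
    refine HasDerivAt.const_add _ (intervalIntegral.integral_hasDerivAt_right hint ?_ ?_)
    · exact ContinuousOn.stronglyMeasurableAtFilter isOpen_Ioo (hc.mono Ioo_subset_Icc_self) x hxI
    · exact hc.continuousAt (Icc_mem_nhds hxI.1 hxI.2)
  refine hd.congr_of_eventuallyEq ?_
  filter_upwards [Icc_mem_nhds hxI.1 hxI.2] with y hy using e y hy

/-- The energy density `u² + α (∂ₓu)²`. -/
noncomputable def energyDensity (α xl xr : ℝ) (u : ℝ → ℝ → ℝ) (t x : ℝ) : ℝ :=
  u t x ^ 2 + α * dX xl xr 1 u t x ^ 2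

/-- The energy flux of `u` through the point `x`. -/
noncomputable def fluxAt (α c ε xl xr : ℝ) (u : ℝ → ℝ → ℝ) (x t : ℝ) : ℝ :=
  flux α c ε (fun t => u t x) (fun t => dX xl xr 1 u t x) (fun t => dX xl xr 2 u t x)
    (fun t => dTdX xl xr 1 u t x) t

variable {α c ε : ℝ} {u₀ : ℝ → ℝ}

/-- The equation tested with `u` and integrated by parts in `x`. -/
lemma IsSolution.integral_eq_flux (h : IsSolution α c ε xl xr u₀ u) (hx : xl < xr) {t : ℝ}
    (ht : 0 < t) :
    ∫ x in xl..xr, (2 * (u t x * dTdX xl xr 0 u t x)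
        + 2 * α * (dX xl xr 1 u t x * dTdX xl xr 1 u t x))
      = -2 * (fluxAt α c ε xl xr u xr t - fluxAt α c ε xl xr u xl t) := by
  have hr := h.regular
  have c0 : ContinuousOn (u t) (Icc xl xr) :=
    (hr.continuousOn_dX (k := 0) (by omega) ht).congr fun x _ => (dX_zero t x).symm
  have c1 := hr.continuousOn_dX (k := 1) (by omega) ht
  have c2 := hr.continuousOn_dX (k := 2) (by omega) ht
  have d0 := hr.continuousOn_dTdX (k := 0) (by omega) ht
  have d1 := hr.continuousOn_dTdX (k := 1) (by omega) ht
  have key : ∀ x ∈ Ioo xl xr, HasDerivAt (fun x => -2 * fluxAt α c ε xl xr u x t)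
      (2 * (u t x * dTdX xl xr 0 u t x) + 2 * α * (dX xl xr 1 u t x * dTdX xl xr 1 u t x)) x := by
    intro x hxI
    have hxI' := Ioo_subset_Icc_self hxI
    have e0 : HasDerivAt (u t) (dX xl xr 1 u t x) x := by
      have := hr.hasDerivAt_dX hx (k := 0) (by omega) ht hxI
      rwa [show dX xl xr 0 u t = u t from funext (dX_zero t)] at this
    have e1 := hr.hasDerivAt_dX hx (k := 1) (by omega) ht hxI
    have e2 := hr.hasDerivAt_dX hx (k := 2) (by omega) ht hxI
    have e3 := hr.hasDerivAt_dTdX hx (k := 1) le_rfl ht hxI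
    have eq := h.equation t ht x hxI
    have et : deriv (fun τ => u τ x - α * dX xl xr 2 u τ x) t
        = dTdX xl xr 0 u t x - α * dTdX xl xr 2 u t x := by
      have t0 := hr.hasDerivAt_time (k := 0) (by omega) ht hxI'
      simp only [dX_zero] at t0
      exact (t0.sub ((hr.hasDerivAt_time (k := 2) le_rfl ht hxI').const_mul α)).deriv
    rw [et] at eq
    have := ((((e0.pow 2).const_mul (c / 2)).add
      (((e0.mul e2).sub ((e1.pow 2).div_const 2)).const_mul ε)).sub
        ((e0.mul e3).const_mul α)).const_mul (-2)
    refine HasDerivAt.congr_deriv this ?_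
    simp only [Nat.reduceAdd, Nat.cast_ofNat, Nat.add_one_sub_one, pow_one]
    linear_combination (-2 * u t x) * eq
  have hcont : ContinuousOn (fun x => -2 * fluxAt α c ε xl xr u x t) (Icc xl xr) := by
    unfold fluxAt flux
    fun_prop
  rw [intervalIntegral.integral_eq_sub_of_hasDerivAt_of_le hx.le hcont key]
  · ring
  · exact ContinuousOn.intervalIntegrable (by rw [uIcc_of_le hx.le]; fun_prop)

lemma IsRegular.continuousOn_fluxAt (h : IsRegular xl xr u) {x : ℝ} (hxI : x ∈ Icc xl xr) :
    ContinuousOn (fluxAt α c ε xl xr u x) (Ioi 0) := by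
  have c0 : ContinuousOn (fun t => u t x) (Ioi 0) :=
    (h.continuousOn_dX_time (k := 0) (by omega) hxI).congr fun t _ => (dX_zero t x).symm
  have c1 := h.continuousOn_dX_time (k := 1) (by omega) hxI
  have c2 := h.continuousOn_dX_time (k := 2) (by omega) hxI
  have d1 := h.continuousOn_dTdX_time (k := 1) (by omega) hxI
  unfold fluxAt flux
  fun_prop

/-- The energy balance on `[δ, T]` for `δ > 0`. -/
lemma IsSolution.energy_sub_eq (h : IsSolution α c ε xl xr u₀ u) (hx : xl < xr) {δ T : ℝ}
    (hδ : 0 < δ) (hδT : δ ≤ T) :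
    (∫ x in xl..xr, energyDensity α xl xr u T x) - ∫ x in xl..xr, energyDensity α xl xr u δ x
      = -2 * ((∫ t in δ..T, fluxAt α c ε xl xr u xr t)
        - ∫ t in δ..T, fluxAt α c ε xl xr u xl t) := by
  have hr := h.regular
  have c0 : ContinuousOn (fun p : ℝ × ℝ => u p.1 p.2) (Ioi 0 ×ˢ Icc xl xr) :=
    (hr.continuousOn_pos 0 (by omega)).congr fun p _ => (dX_zero p.1 p.2).symm
  have c1 := hr.continuousOn_pos 1 (by omega)
  have d0 := hr.continuousOn_time 0 (by omega)
  have d1 := hr.continuousOn_time 1 (by omega)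
  have hder : ∀ t, 0 < t → HasDerivAt (fun τ => ∫ x in xl..xr, energyDensity α xl xr u τ x)
      (-2 * (fluxAt α c ε xl xr u xr t - fluxAt α c ε xl xr u xl t)) t := by
    intro t ht
    rw [← h.integral_eq_flux hx ht]
    refine hasDerivAt_integral_of_continuousOn hx.le
      (f' := fun t x => 2 * (u t x * dTdX xl xr 0 u t x)
        + 2 * α * (dX xl xr 1 u t x * dTdX xl xr 1 u t x)) ?_ ?_ ?_ ht
    · intro τ hτ
      have b0 : ContinuousOn (u τ) (Icc xl xr) :=
        (hr.continuousOn_dX (k := 0) (by omega) hτ).congr fun x _ => (dX_zero τ x).symm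
      have b1 := hr.continuousOn_dX (k := 1) (by omega) hτ
      unfold energyDensity
      fun_prop
    · intro τ hτ x hxI
      have t0 := hr.hasDerivAt_time (k := 0) (by omega) hτ hxI
      simp only [dX_zero] at t0
      have t1 := hr.hasDerivAt_time (k := 1) (by omega) hτ hxI
      refine ((t0.pow 2).add ((t1.pow 2).const_mul α)).congr_deriv ?_
      simp only [Nat.cast_ofNat, Nat.add_one_sub_one, pow_one]
      ring
    · fun_prop
  have hsub : uIcc δ T ⊆ Ioi 0 := by
    rw [uIcc_of_le hδT]
    exact fun t ht => hδ.trans_le ht.1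
  have ir : IntervalIntegrable (fluxAt α c ε xl xr u xr) volume δ T :=
    ((hr.continuousOn_fluxAt (right_mem_Icc.2 hx.le)).mono hsub).intervalIntegrable
  have il : IntervalIntegrable (fluxAt α c ε xl xr u xl) volume δ T :=
    ((hr.continuousOn_fluxAt (left_mem_Icc.2 hx.le)).mono hsub).intervalIntegrable
  rw [← intervalIntegral.integral_eq_sub_of_hasDerivAt (fun t ht => hder t (hsub ht))
    ((ir.sub il).const_mul _), intervalIntegral.integral_const_mul,
    intervalIntegral.integral_sub ir il]

/-- The energy is continuous up to `t = 0`. -/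
lemma IsRegular.tendsto_energy (h : IsRegular xl xr u) (hx : xl < xr) :
    Tendsto (fun δ => ∫ x in xl..xr, energyDensity α xl xr u δ x) (𝓝[>] (0 : ℝ))
      (𝓝 (∫ x in xl..xr, energyDensity α xl xr u 0 x)) := by
  have c0 : ContinuousOn (fun p : ℝ × ℝ => u p.1 p.2) (Ici 0 ×ˢ Icc xl xr) :=
    (h.continuousOn_nonneg 0 (by omega)).congr fun p _ => (dX_zero p.1 p.2).symm
  have c1 := h.continuousOn_nonneg 1 le_rfl
  have hc : ContinuousOn (fun p : ℝ × ℝ => energyDensity α xl xr u p.1 p.2)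
      (Ici 0 ×ˢ Icc xl xr) := by
    unfold energyDensity
    fun_prop
  have hK : Icc (0 : ℝ) 1 ×ˢ Icc xl xr ⊆ Ici 0 ×ˢ Icc xl xr :=
    prod_mono Icc_subset_Ici_self subset_rfl
  obtain ⟨C, hC⟩ := (isCompact_Icc.prod isCompact_Icc).exists_bound_of_continuousOn (hc.mono hK)
  have hmem : ∀ᶠ δ : ℝ in 𝓝[>] (0 : ℝ), δ ∈ Ioo (0 : ℝ) 1 := Ioo_mem_nhdsGT one_pos
  refine intervalIntegral.tendsto_integral_filter_of_dominated_convergence (fun _ => C) ?_ ?_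
    intervalIntegrable_const ?_
  · filter_upwards [hmem] with δ hδ
    rw [uIoc_of_le hx.le]
    refine ContinuousOn.aestronglyMeasurable ?_ measurableSet_Ioc
    exact hc.comp (f := fun x => (δ, x)) (by fun_prop)
      fun x hx' => ⟨hδ.1.le, Ioc_subset_Icc_self hx'⟩
  · filter_upwards [hmem] with δ hδ
    refine Eventually.of_forall fun x hx' => ?_
    rw [uIoc_of_le hx.le] at hx'
    exact hC (δ, x) ⟨Ioo_subset_Icc_self hδ, Ioc_subset_Icc_self hx'⟩
  · refine Eventually.of_forall fun x hx' => ?_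
    rw [uIoc_of_le hx.le] at hx'
    have : ContinuousOn (fun δ => energyDensity α xl xr u δ x) (Ici 0) :=
      hc.comp (f := fun δ => (δ, x)) (by fun_prop) fun δ hδ => ⟨hδ, Ioc_subset_Icc_self hx'⟩
    exact (this 0 self_mem_Ici).tendsto.mono_left (nhdsWithin_mono 0 Ioi_subset_Ici_self)

lemma IsSolution.eqOn_datum (h : IsSolution α c ε xl xr u₀ u) (hx : xl < xr)
    (hu₀ : Continuous u₀) : EqOn (u 0) u₀ (Icc xl xr) :=
  EqOn.of_subset_closure (s := Ioo xl xr) h.datum h.regular.contDiffOn_zero.continuousOn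
    hu₀.continuousOn Ioo_subset_Icc_self (closure_Ioo hx.ne).ge

lemma eq_zero_right_of_tsupport_subset (hu₀ : Continuous u₀) (hsupp : tsupport u₀ ⊆ Icc xl xr) :
    u₀ xr = 0 := by
  have h : EqOn u₀ (fun _ => 0) (Ioi xr) := fun x hx =>
    image_eq_zero_of_notMem_tsupport fun h' => not_lt_of_ge (hsupp h').2 hx
  exact (h.closure hu₀ continuous_const) (by rw [closure_Ioi]; exact self_mem_Ici)

lemma eq_zero_left_of_tsupport_subset (hu₀ : Continuous u₀) (hsupp : tsupport u₀ ⊆ Icc xl xr) :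
    u₀ xl = 0 := by
  have h : EqOn u₀ (fun _ => 0) (Iio xl) := fun x hx =>
    image_eq_zero_of_notMem_tsupport fun h' => not_lt_of_ge (hsupp h').1 hx
  exact (h.closure hu₀ continuous_const) (by rw [closure_Iio]; exact self_mem_Iic)

lemma IsSolution.integral_energyDensity_zero (h : IsSolution α c ε xl xr u₀ u) (hx : xl < xr) :
    ∫ x in xl..xr, energyDensity α xl xr u 0 x
      = ∫ x in xl..xr, (u₀ x ^ 2 + α * deriv u₀ x ^ 2) := by
  rw [intervalIntegral.integral_of_le hx.le, intervalIntegral.integral_of_le hx.le,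
    integral_Ioc_eq_integral_Ioo, integral_Ioc_eq_integral_Ioo]
  refine setIntegral_congr_fun measurableSet_Ioo fun x hxI => ?_
  have hev : u 0 =ᶠ[𝓝 x] u₀ := by
    filter_upwards [Ioo_mem_nhds hxI.1 hxI.2] with y hy using h.datum y hy
  simp only [energyDensity, dX, iteratedDerivWithin_one]
  rw [derivWithin_of_mem_nhds (Icc_mem_nhds hxI.1 hxI.2), hev.deriv_eq, h.datum x hxI]

lemma IsRegular.isTrace (h : IsRegular xl xr u) {x : ℝ} (hxI : x ∈ Icc xl xr) (h0 : u 0 x = 0) :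
    IsTrace (fun t => u t x) (fun t => dX xl xr 1 u t x) (fun t => dX xl xr 2 u t x)
      (fun t => dTdX xl xr 0 u t x) (fun t => dTdX xl xr 1 u t x) where
  g_cont := ((h.continuousOn_nonneg 0 (by omega)).comp (f := fun t => (t, x)) (by fun_prop)
    fun _ ht => ⟨ht, hxI⟩).congr fun t _ => (dX_zero t x).symm
  v_cont := (h.continuousOn_nonneg 1 le_rfl).comp (f := fun t => (t, x)) (by fun_prop)
    fun _ ht => ⟨ht, hxI⟩
  q_cont := h.continuousOn_dX_time (by omega) hxI
  g_deriv t ht := by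
    have := h.hasDerivAt_time (k := 0) (by omega) ht hxI
    simpa only [dX_zero] using this
  v_deriv t ht := h.hasDerivAt_time (by omega) ht hxI
  g'_cont := h.continuousOn_dTdX_time (by omega) hxI
  v'_cont := h.continuousOn_dTdX_time (by omega) hxI
  g_zero := h0

end Energy

/-! ### The boundary conditions on the imaginary axis -/

section Symbol

variable {α c ε : ℝ}

lemma isDissipativeSymbol_lambda1Bdry (hα : 0 < α) (hε : 0 < ε)
    (hcond : ∀ ξ : ℝ, 0 ≤ c / 2
        + ε * ((lambda1Bdry α c ε ξ ^ 2).re - ‖lambda1Bdry α c ε ξ‖ ^ 2 / 2)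
        - α * (Complex.I * (ξ : ℂ) * lambda1Bdry α c ε ξ).re) :
    IsDissipativeSymbol α c ε (1 / √α) fun ξ => lambda1Bdry α c ε (2 * Real.pi * ξ) where
  measurable := (measurable_lambda1Bdry hα hε).comp (by fun_prop)
  bounded := ⟨_, fun ξ => norm_lambda1Bdry_le hα hε _⟩
  bounded_remainder := ⟨_, fun ξ => norm_mul_lambda1Bdry_add_le hα hε _⟩
  nonneg ξ := by
    refine (hcond (2 * Real.pi * ξ)).trans_eq ?_
    congr 2
    rw [mul_add, Complex.add_re, mul_comm Complex.I]
    simp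

variable {T : ℝ} {g φ : ℝ → ℝ}

lemma norm_lambda1_sq_le (hα : 0 < α) (hε : 0 < ε) {s : ℂ} (hs : 0 < s.re) :
    ‖lambda1 α c ε s ^ 2‖ ≤ √(max (1 / α) (|c| / ε)) ^ 2 := by
  rw [norm_pow]
  exact pow_le_pow_left₀ (norm_nonneg _) (norm_lambda1_le hα hε hs) 2

lemma tendsto_invLaplaceConv_lambda1 (hα : 0 < α) (hε : 0 < ε) (hT : 0 < T)
    (hg : ContinuousOn g (Icc 0 T)) (hφ : IsTest T φ) :
    Tendsto (fun σ : ℝ => invLaplaceConv σ (fun s => lambda1 α c ε s) T g φ) (𝓝[>] (0 : ℝ))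
      (𝓝 (pairing T (fun ξ => lambda1Bdry α c ε (2 * Real.pi * ξ)) g φ)) := by
  refine tendsto_invLaplaceConv hT (C := √(max (1 / α) (|c| / ε)))
    (F₀ := fun y => lambda1Bdry α c ε y)
    (fun σ hσ => measurable_lambda1_line hα hε hσ) (fun s hs => ?_)
    (fun y => tendsto_lambda1Bdry hα hε y) hg hφ
  refine (norm_lambda1_le hα hε hs).trans ?_
  nlinarith [norm_nonneg s, Real.sqrt_nonneg (max (1 / α) (|c| / ε))]

lemma tendsto_invLaplaceConv_lambda1_sq (hα : 0 < α) (hε : 0 < ε) (hT : 0 < T)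
    (hg : ContinuousOn g (Icc 0 T)) (hφ : IsTest T φ) :
    Tendsto (fun σ : ℝ => invLaplaceConv σ (fun s => lambda1 α c ε s ^ 2) T g φ) (𝓝[>] (0 : ℝ))
      (𝓝 (pairing T (fun ξ => lambda1Bdry α c ε (2 * Real.pi * ξ) ^ 2) g φ)) := by
  refine tendsto_invLaplaceConv hT (C := √(max (1 / α) (|c| / ε)) ^ 2)
    (F₀ := fun y => lambda1Bdry α c ε y ^ 2)
    (fun σ hσ => (measurable_lambda1_line hα hε hσ).pow_const 2) (fun s hs => ?_)
    (fun y => (tendsto_lambda1Bdry hα hε y).pow 2) hg hφ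
  refine (norm_lambda1_sq_le hα hε hs).trans ?_
  nlinarith [norm_nonneg s, sq_nonneg √(max (1 / α) (|c| / ε))]

lemma norm_mul_div_of_pos (hα : 0 < α) (hε : 0 < ε) (s : ℂ) :
    ‖(α : ℂ) * s / (ε : ℂ)‖ = α / ε * ‖s‖ := by
  rw [norm_div, norm_mul, Complex.norm_real, Complex.norm_real, Real.norm_of_nonneg hα.le,
    Real.norm_of_nonneg hε.le]
  ring

lemma tendsto_invLaplaceConv_left_first (hα : 0 < α) (hε : 0 < ε) (hT : 0 < T)
    (hg : ContinuousOn g (Icc 0 T)) (hφ : IsTest T φ) :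
    Tendsto (fun σ : ℝ => invLaplaceConv σ
      (fun s => lambda1 α c ε s - (α : ℂ) * s / (ε : ℂ)) T g φ) (𝓝[>] (0 : ℝ))
      (𝓝 (pairing T (fun ξ => lambda1Bdry α c ε (2 * Real.pi * ξ)
        - α * ((2 * Real.pi * ξ : ℝ) * Complex.I) / ε) g φ)) := by
  set N := √(max (1 / α) (|c| / ε)) with hN
  refine tendsto_invLaplaceConv hT (C := N + α / ε)
    (F₀ := fun y => lambda1Bdry α c ε y - α * ((y : ℂ) * Complex.I) / ε)
    (fun σ hσ => (measurable_lambda1_line hα hε hσ).sub (by fun_prop)) (fun s hs => ?_)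
    (fun y => (tendsto_lambda1Bdry hα hε y).sub
      (((tendsto_line y).const_mul (α : ℂ)).div_const (ε : ℂ))) hg hφ
  refine (norm_sub_le _ _).trans ?_
  rw [norm_mul_div_of_pos hα hε]
  have h1 := norm_lambda1_le (c := c) hα hε hs
  have h2 : 0 ≤ N * ‖s‖ := by positivity
  have h3 : 0 ≤ α / ε := by positivity
  nlinarith

lemma tendsto_invLaplaceConv_left_second (hα : 0 < α) (hε : 0 < ε) (hT : 0 < T)
    (hg : ContinuousOn g (Icc 0 T)) (hφ : IsTest T φ) :
    Tendsto (fun σ : ℝ => invLaplaceConv σ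
      (fun s => lambda1 α c ε s ^ 2 - (α : ℂ) * s / (ε : ℂ) * lambda1 α c ε s) T g φ)
      (𝓝[>] (0 : ℝ))
      (𝓝 (pairing T (fun ξ => lambda1Bdry α c ε (2 * Real.pi * ξ) ^ 2
        - α * ((2 * Real.pi * ξ : ℝ) * Complex.I) / ε
          * lambda1Bdry α c ε (2 * Real.pi * ξ)) g φ)) := by
  set N := √(max (1 / α) (|c| / ε)) with hN
  refine tendsto_invLaplaceConv hT (C := N ^ 2 + α / ε * N)
    (F₀ := fun y => lambda1Bdry α c ε y ^ 2
      - α * ((y : ℂ) * Complex.I) / ε * lambda1Bdry α c ε y)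
    (fun σ hσ => ((measurable_lambda1_line hα hε hσ).pow_const 2).sub
      (Measurable.mul (by fun_prop) (measurable_lambda1_line hα hε hσ))) (fun s hs => ?_)
    (fun y => ((tendsto_lambda1Bdry hα hε y).pow 2).sub
      ((((tendsto_line y).const_mul (α : ℂ)).div_const (ε : ℂ)).mul
        (tendsto_lambda1Bdry hα hε y))) hg hφ
  refine (norm_sub_le _ _).trans ?_
  rw [norm_mul, norm_mul_div_of_pos hα hε]
  have h0 := norm_lambda1_sq_le (c := c) hα hε hs
  have h1 := mul_le_mul_of_nonneg_left (norm_lambda1_le (c := c) hα hε hs)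
    (by positivity : 0 ≤ α / ε * ‖s‖)
  rw [← hN] at h0 h1
  have h2 : 0 ≤ N ^ 2 * ‖s‖ := by positivity
  have h3 : 0 ≤ α / ε * N := by positivity
  nlinarith

end Symbol

/-! ### Stability -/

section Stability

variable {α c ε xl xr : ℝ} {u₀ : ℝ → ℝ} {u : ℝ → ℝ → ℝ}

lemma IsSolution.energy_le (hα : 0 < α) (hε : 0 < ε) (hx : xl < xr)
    (hcond : ∀ ξ : ℝ, 0 ≤ c / 2
        + ε * ((lambda1Bdry α c ε ξ ^ 2).re - ‖lambda1Bdry α c ε ξ‖ ^ 2 / 2)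
        - α * (Complex.I * (ξ : ℂ) * lambda1Bdry α c ε ξ).re)
    (hu₀ : Continuous u₀) (hsupp : tsupport u₀ ⊆ Icc xl xr)
    (hu : IsSolution α c ε xl xr u₀ u) {t : ℝ} (ht : 0 < t) :
    ∫ x in xl..xr, energyDensity α xl xr u t x
      ≤ ∫ x in xl..xr, (u₀ x ^ 2 + α * deriv u₀ x ^ 2) := by
  have hr := hu.regular
  have hmr : xr ∈ Icc xl xr := right_mem_Icc.2 hx.le
  have hml : xl ∈ Icc xl xr := left_mem_Icc.2 hx.le
  have hl := isDissipativeSymbol_lambda1Bdry hα hε hcond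
  have htr := hr.isTrace hmr (by
    rw [hu.eqOn_datum hx hu₀ hmr, eq_zero_right_of_tsupport_subset hu₀ hsupp])
  have htl := hr.isTrace hml (by
    rw [hu.eqOn_datum hx hu₀ hml, eq_zero_left_of_tsupport_subset hu₀ hsupp])
  have hpos : ∀ᶠ σ : ℝ in 𝓝[>] (0 : ℝ), 0 < σ := self_mem_nhdsWithin
  obtain ⟨R, hR, hRlim⟩ := exists_tendsto_flux_right hα hε (by positivity) ht hl htr
    (fun φ hφ => tendsto_nhds_unique
      (tendsto_const_nhds.congr' (hpos.mono fun σ hσ => hu.right_first t φ hφ σ hσ))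
      (tendsto_invLaplaceConv_lambda1 hα hε ht htr.g_contOn hφ))
    (fun φ hφ => tendsto_nhds_unique
      (tendsto_const_nhds.congr' (hpos.mono fun σ hσ => hu.right_second t φ hφ σ hσ))
      (tendsto_invLaplaceConv_lambda1_sq hα hε ht htr.g_contOn hφ))
  obtain ⟨Q, hQ, hQlim⟩ := exists_tendsto_flux_left hα hε (by positivity) ht hl htl
    (fun φ hφ => tendsto_nhds_unique
      (((tendsto_const_nhds.add
        (tendsto_invLaplaceConv_left_first hα hε ht htl.v_contOn hφ)).add
        (tendsto_invLaplaceConv_left_second hα hε ht htl.g_contOn hφ)).add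
          tendsto_const_nhds)
      (tendsto_const_nhds.congr' (hpos.mono fun σ hσ => (hu.left t φ hφ σ hσ).symm)))
  have h1 := (hRlim.sub hQlim).const_mul (-2)
  have h2 := (tendsto_const_nhds (x := ∫ x in xl..xr, energyDensity α xl xr u t x)).sub
    (hr.tendsto_energy (α := α) hx)
  have h3 := tendsto_nhds_unique (h2.congr' (by
    filter_upwards [Ioo_mem_nhdsGT ht] with δ hδ
    exact hu.energy_sub_eq hx hδ.1 hδ.2.le)) h1
  rw [hu.integral_energyDensity_zero hx] at h3
  linarith

end Stability

end KdVBBM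

theorem mainTheorem1 (α c ε xl xr : ℝ) (hα : 0 < α) (hε : 0 < ε) (hx : xl < xr)
    (hcond : ∀ ξ : ℝ,
      0 ≤ c / 2
        + ε * ((KdVBBM.lambda1Bdry α c ε ξ ^ 2).re - ‖KdVBBM.lambda1Bdry α c ε ξ‖ ^ 2 / 2)
        - α * (Complex.I * (ξ : ℂ) * KdVBBM.lambda1Bdry α c ε ξ).re)
    (u₀ : ℝ → ℝ) (hu₀ : Continuous u₀) (hsupp : tsupport u₀ ⊆ Set.Icc xl xr)
    (u : ℝ → ℝ → ℝ) (hu : KdVBBM.IsSolution α c ε xl xr u₀ u) (t : ℝ) (ht : 0 < t) :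
    ∫ x in xl..xr, (u t x ^ 2 + α * KdVBBM.dX xl xr 1 u t x ^ 2)
      ≤ ∫ x in xl..xr, (u₀ x ^ 2 + α * deriv u₀ x ^ 2) :=
  KdVBBM.IsSolution.energy_le hα hε hx hcond hu₀ hsupp hu ht
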